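/- **Theorem.** Let $d\ge 1$. For a finite alphabet $C$ (with the discrete topology), give $C^{\mathbb{Z}^d}$ the product topology and the shift action $(T^g x)(h)=x(g+h)$, $g,h\in\mathbb{Z}^d$. A subshift is a closed shift-invariant set $X\subseteq C^{\mathbb{Z}^d}$ with the restricted action; it has topological entropy $h(X)$ if $$h(X)=\lim_{n\to\infty}\frac{\log\left|\{x|_{[0,n)^d} : x\in X\}\right|}{n^d},$$ where $[0,n)^d=\{0,\dots,n-1\}^d\subset\mathbb{Z}^d$. The subshift $X$ is totally strictly ergodic if, for every subgroup $F\le\mathbb{Z}^d$ of finite index, the restriction of the action to $F$ is minimal (for every $x\in X$ the orbit $\{T^g x : g\in F\}$ is dense in $X$) and uniquely ergodic (there is exactly one $F$-invariant Borel probability measure on $X$). 1. For every finite alphabet $C$ with $|C|\ge 2$ and every $\nu\in(0,1)$ there is a totally strictly ergodic subshift $X\subseteq C^{\mathbb{Z}^d}$ whose topological entropy exists and satisfies $h(X)\ge(1-\nu)\log|C|$. 2. In particular, there are totally strictly ergodic $\mathbb{Z}^d$-actions with arbitrarily large positive topological entropy: for every $M\in\mathbb{R}$ there are a finite alphabet $C$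 and a totally strictly ergodic subshift $X\subseteq C^{\mathbb{Z}^d}$ whose topological entropy exists and satisfies $h(X)>0$ and $h(X)\ge M$. -/

import Mathlib

open Filter Topology MeasureTheory
open SymbolicDynamics.FullShift

/-- The shift action on a subshift `X ⊆ A ^ G` of an additive commutative group `G`:
`(g +ᵥ x) h = x (g + h)`. -/
instance subshiftAction {A G : Type*} [TopologicalSpace A] [AddCommGroup G]
    (X : Subshift A G) : AddAction G X.carrier where
  vadd g x := ⟨shift g x.1, X.mapsTo g x.2⟩
  zero_vadd x := Subtype.ext (shift_zero x.1)
  add_vadd g h x := Subtype.ext (by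
    change shift (g + h) x.1 = shift g (shift h x.1)
    rw [add_comm g h, shift_add])

/-- An action of `G` on `X` is uniquely ergodic if there is exactly one `G`-invariant Borel
probability measure on `X`. -/
def IsUniquelyErgodic (G X : Type*) [AddGroup G] [AddAction G X] [TopologicalSpace X]
    [MeasurableSpace X] [BorelSpace X] : Prop :=
  ∃! μ : Measure X, IsProbabilityMeasure μ ∧ VAddInvariantMeasure G X μ

/-- Strictly ergodic: minimal (every orbit is dense) and uniquely ergodic. -/
def IsStrictlyErgodic (G X : Type*) [AddGroup G] [AddAction G X] [TopologicalSpace X]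
    [MeasurableSpace X] [BorelSpace X] : Prop :=
  AddAction.IsMinimal G X ∧ IsUniquelyErgodic G X

/-- Totally strictly ergodic: the restriction of the action to every subgroup of finite index
is strictly ergodic. -/
def IsTotallyStrictlyErgodic (G X : Type*) [AddGroup G] [AddAction G X] [TopologicalSpace X]
    [MeasurableSpace X] [BorelSpace X] : Prop :=
  ∀ F : AddSubgroup G, F.FiniteIndex → IsStrictlyErgodic F X

/-- The cube `[0, n)^d` in `ℤ^d`. -/
def cube (d n : ℕ) : Set (Fin d → ℤ) := {g | ∀ i, 0 ≤ g i ∧ g i < (n : ℤ)}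

/-- The set of configurations supported in `S` that occur in elements of `X`. -/
def patternsOn {A G : Type*} (X : Set (G → A)) (S : Set G) : Set (S → A) :=
  S.domRestrict '' X

/-- `HasTopologicalEntropy X h`: the topological entropy of the `ℤ^d`-subshift `X` exists, as the
limit of `log |patterns of X on [0, n)^d| / n ^ d`, and is equal to `h`. -/
def HasTopologicalEntropy {A : Type*} [TopologicalSpace A] {d : ℕ}
    (X : Subshift A (Fin d → ℤ)) (h : ℝ) : Prop :=
  Tendsto (fun n : ℕ => Real.log ((patternsOn X.carrier (cube d n)).ncard : ℝ) / (n : ℝ) ^ d)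
    atTop (𝓝 h)

/-!
The subshift is generated by a hierarchy of blocks, that is, of families of patterns on cubes
`[0, n_k)^d`. At level `0` all patterns on a large cube are allowed (`BlockFamily.full`). The
blocks of level `k + 1` are obtained by writing blocks of level `k` into the cells of a grid
(`BlockFamily.next`), subject to two rules.

* The cells are indexed by pairs `(r, a)`, where `r` is the residue of the cell modulo
  `2 * (k + 1)!` in each coordinate, and for each `r` every block of level `k` is used in exactly
  the same number of cells `(r, a)`. This is achieved by letting the choices along fibres of cells
  be arbitrary permutations of the set of blocks (`Filling`), so there are still enough choices:
  by Stirling's formula, `log t!` is almost `t * log t`.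
* The cells have side `n_k + 1`, and the block sits at the lower or at the upper end of its cell
  according to `r` (`cellStart`). For fixed `M`, once `M` divides `n_k`, the positions of the cells
  with residue `r`, as `r` varies, are equidistributed modulo `M`; this destroys all finite factors.
  Since the first and the last block touch the faces of the larger block, the gaps between
  consecutive blocks of level `k` are at most `2` on every higher level (`BlockFamily.Tiles`), so
  the padding never accumulates.

Hence the number of occurrences of a pattern in a block of level `k + 1`, at positions in a given
residue class modulo `M`, depends neither on the block nor on the class, up to a small proportion
of occurrences that are not inside a block of level `k`
(`BlockFamily.exists_count_next_bounds`). Large windows are almost tiled by such blocks, so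
patterns have uniform frequencies along `M ℤ^d` (`BlockFamily.exists_window_bounds`). As a subgroup
of finite index contains some `M ℤ^d`, all its invariant measures agree on patterns
(`BlockFamily.measure_patternSet_eq`), which gives unique ergodicity together with the
Krylov–Bogoliubov theorem (`exists_invariant_probabilityMeasure`). Minimality holds because every
configuration contains blocks of level `k + 1`, and these contain every block of level `k` in every
residue class (`BlockFamily.exists_block_eq_of_mem_limitSet`).

The entropy exists by subadditivity (`exists_hasTopologicalEntropy`). Passing from level `k` to
`k + 1` changes the entropy per site of the blocks by `O(1 / n_k)`, and `n_k ≥ 2 ^ k * n_0`, so the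
total loss is small if `n_0` is large (`BlockFamily.log_card_level_ge`).
-/

/-! ### Cells on a line -/

/-- The left end of the block placed in the cell with index `r + 2 * N * a` of a line, where cells
have length `n + 1` and blocks have length `n`. The block sits at the left end of its cell if
`r < N` and at the right end if `N ≤ r`, so that the starting points of the blocks in the cells
with a given `a` are equidistributed modulo the common divisors of `N` and `n`, while the first and
the last block touch the ends of the line. -/
def cellStart (n : ℕ) {N t : ℕ} (r : Fin (2 * N)) (a : Fin t) : ℤ :=
  ((r : ℕ) + 2 * N * (a : ℕ) : ℤ) * (n + 1) + ((r : ℕ) / N : ℕ)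

section cellStart

variable {n N t : ℕ}

lemma fin_div_le_one (r : Fin (2 * N)) : (r : ℕ) / N ≤ 1 := by
  have : (r : ℕ) / N < 2 := Nat.div_lt_of_lt_mul (by have := r.2; linarith)
  omega

lemma cellIndex_lt (r : Fin (2 * N)) (a : Fin t) :
    (r : ℕ) + 2 * N * (a : ℕ) + 1 ≤ 2 * N * t := by
  have h1 := r.2
  have h2 : (a : ℕ) + 1 ≤ t := a.2
  calc (r : ℕ) + 2 * N * (a : ℕ) + 1 ≤ 2 * N * ((a : ℕ) + 1) := by rw [mul_add]; omega
    _ ≤ 2 * N * t := Nat.mul_le_mul_left _ h2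

lemma cellStart_nonneg (r : Fin (2 * N)) (a : Fin t) : 0 ≤ cellStart n r a := by
  unfold cellStart; positivity

lemma cellStart_add_le (r : Fin (2 * N)) (a : Fin t) :
    cellStart n r a + n ≤ ((2 * N * t * (n + 1) : ℕ) : ℤ) := by
  have h1 := fin_div_le_one r
  have h2 := cellIndex_lt r a
  have h3 := Nat.mul_le_mul_right (n + 1) h2
  unfold cellStart
  push_cast
  zify at h1 h3
  nlinarith

lemma cellStart_bounds (r : Fin (2 * N)) (a : Fin t) :
    (((r : ℕ) + 2 * N * (a : ℕ) : ℕ) : ℤ) * (n + 1) ≤ cellStart n r a ∧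
      cellStart n r a ≤ (((r : ℕ) + 2 * N * (a : ℕ) : ℕ) : ℤ) * (n + 1) + 1 := by
  have h1 : (((r : ℕ) / N : ℕ) : ℤ) ≤ 1 := by exact_mod_cast fin_div_le_one r
  have h2 : 0 ≤ (((r : ℕ) / N : ℕ) : ℤ) := Int.natCast_nonneg _
  unfold cellStart
  rw [Nat.cast_add, Nat.cast_mul, Nat.cast_mul, Nat.cast_ofNat]
  constructor <;> linarith

lemma cellIndex_inj {r r' : Fin (2 * N)} {a a' : Fin t}
    (h : (r : ℕ) + 2 * N * (a : ℕ) = r' + 2 * N * (a' : ℕ)) : r = r' ∧ a = a' := by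
  have hN : 0 < 2 * N := Nat.lt_of_le_of_lt (Nat.zero_le _) r.2
  have h1 := congrArg (· % (2 * N)) h
  have h2 := congrArg (· / (2 * N)) h
  simp only [Nat.add_mul_mod_self_left, Nat.mod_eq_of_lt r.2, Nat.mod_eq_of_lt r'.2] at h1
  simp only [Nat.add_mul_div_left _ _ hN, Nat.div_eq_of_lt r.2, Nat.div_eq_of_lt r'.2] at h2
  exact ⟨Fin.ext h1, Fin.ext (by omega)⟩

/-- Blocks in different cells are ordered like their cells and do not overlap. -/
lemma cellStart_add_le_of_lt {r r' : Fin (2 * N)} {a a' : Fin t}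
    (h : (r : ℕ) + 2 * N * (a : ℕ) < r' + 2 * N * (a' : ℕ)) :
    cellStart n r a + n ≤ cellStart n r' a' := by
  have h1 := (cellStart_bounds (n := n) r a).2
  have h2 := (cellStart_bounds (n := n) r' a').1
  have h3 : (((r : ℕ) + 2 * N * (a : ℕ) : ℕ) : ℤ) + 1 ≤ ((r' + 2 * N * (a' : ℕ) : ℕ) : ℤ) := by
    exact_mod_cast h
  nlinarith [mul_le_mul_of_nonneg_right h3 (by positivity : (0 : ℤ) ≤ (n : ℤ) + 1)]

lemma cellStart_unique {r r' : Fin (2 * N)} {a a' : Fin t} {z : ℤ}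
    (h : 0 ≤ z - cellStart n r a ∧ z - cellStart n r a < n)
    (h' : 0 ≤ z - cellStart n r' a' ∧ z - cellStart n r' a' < n) : r = r' ∧ a = a' := by
  apply cellIndex_inj
  rcases lt_trichotomy ((r : ℕ) + 2 * N * (a : ℕ)) (r' + 2 * N * (a' : ℕ)) with hlt | heq | hgt
  · have := cellStart_add_le_of_lt (n := n) hlt; omega
  · exact heq
  · have := cellStart_add_le_of_lt (n := n) hgt; omega

lemma exists_cellIndex (hN : 0 < N) {j : ℕ} (hj : j < 2 * N * t) :
    ∃ (r : Fin (2 * N)) (a : Fin t), (r : ℕ) + 2 * N * (a : ℕ) = j :=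
  ⟨⟨j % (2 * N), Nat.mod_lt _ (by omega)⟩, ⟨j / (2 * N), Nat.div_lt_of_lt_mul hj⟩,
    Nat.mod_add_div j (2 * N)⟩

/-- Consecutive blocks are at most two apart. -/
lemma exists_cellStart_le (hN : 0 < N) {z : ℤ} (h0 : 0 ≤ z)
    (hz : z < ((2 * N * t * (n + 1) : ℕ) : ℤ)) :
    ∃ (r : Fin (2 * N)) (a : Fin t), cellStart n r a ≤ z ∧ z < cellStart n r a + n + 2 := by
  lift z to ℕ using h0
  have hz' : z < 2 * N * t * (n + 1) := by exact_mod_cast hz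
  obtain ⟨r, a, hra⟩ := exists_cellIndex (t := t) hN
    (j := z / (n + 1)) (Nat.div_lt_of_lt_mul (by rw [mul_comm]; exact hz'))
  have hdm : (z : ℤ) = ((z / (n + 1) : ℕ) : ℤ) * (n + 1) + ((z % (n + 1) : ℕ) : ℤ) := by
    exact_mod_cast (Nat.div_add_mod' z (n + 1)).symm
  have hmod : ((z % (n + 1) : ℕ) : ℤ) < n + 1 := by exact_mod_cast Nat.mod_lt _ (by omega)
  have hmod0 : 0 ≤ ((z % (n + 1) : ℕ) : ℤ) := Int.natCast_nonneg _
  generalize z % (n + 1) = s at hdm hmod hmod0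
  obtain ⟨b1, b2⟩ := cellStart_bounds (n := n) r a
  rw [hra] at b1 b2
  by_cases hle : cellStart n r a ≤ z
  · exact ⟨r, a, hle, by linarith⟩
  · -- `z` is the first point of a cell whose block is shifted; the previous block ends nearby
    have hpos : 0 < z / (n + 1) := by
      by_contra hcon
      have h00 : z / (n + 1) = 0 := by omega
      rw [h00] at hra
      have hr : (r : ℕ) = 0 := by omega
      have ha : 2 * N * (a : ℕ) = 0 := by omega
      apply hle
      unfold cellStart
      have ha' : (2 * N * (a : ℕ) : ℤ) = 0 := by exact_mod_cast ha
      rw [ha', hr]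
      simp
    obtain ⟨j, hj⟩ : ∃ j, z / (n + 1) = j + 1 := ⟨z / (n + 1) - 1, by omega⟩
    obtain ⟨r', a', hra'⟩ := exists_cellIndex (t := t) hN (j := j)
      (by have := cellIndex_lt r a; omega)
    obtain ⟨c1, c2⟩ := cellStart_bounds (n := n) r' a'
    rw [hra'] at c1 c2
    rw [hj] at b1 b2 hdm
    push_cast at b1 b2 hdm c1 c2
    exact ⟨r', a', by linarith, by linarith⟩

lemma exists_cellStart_last (hN : 0 < N) (ht : 0 < t) :
    ∃ (r : Fin (2 * N)) (a : Fin t),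
      cellStart n r a = ((2 * N * t * (n + 1) : ℕ) : ℤ) - n := by
  refine ⟨⟨2 * N - 1, by omega⟩, ⟨t - 1, by omega⟩, ?_⟩
  have h : (2 * N - 1) / N = 1 := by
    rw [Nat.div_eq_iff hN]; omega
  unfold cellStart
  simp only [h]
  obtain ⟨M, rfl⟩ : ∃ M, N = M + 1 := ⟨N - 1, by omega⟩
  obtain ⟨s, rfl⟩ : ∃ s, t = s + 1 := ⟨t - 1, by omega⟩
  have e1 : 2 * (M + 1) - 1 = 2 * M + 1 := by omega
  simp only [e1, Nat.add_sub_cancel]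
  push_cast
  ring

end cellStart

/-! ### Families of blocks and the filling construction -/

/-- A finite family of patterns on the cube `[0, side)^d`, indexed by `Fin card`. Each pattern is
given as a configuration on `ℤ^d`, whose values outside the cube are irrelevant. -/
structure BlockFamily (C : Type*) (d : ℕ) where
  /-- The side length of the cube. -/
  side : ℕ
  /-- The number of blocks. -/
  card : ℕ
  /-- The blocks. -/
  config : Fin card → (Fin d → ℤ) → C

/-- An arbitrary splitting of `(Fin d → Fin t)` into `t ^ (d - 1)` fibres of size `t`. -/
noncomputable def fiberEquiv (d t : ℕ) [NeZero d] : (Fin d → Fin t) ≃ Fin t × Fin (t ^ (d - 1)) :=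
  Fintype.equivOfCardEq (by simp [mul_pow_sub_one (NeZero.ne d)])

/-- A choice of one of `t` blocks for each cell `(r, a)`, such that every block occurs equally
often in the cells with given `r`: on each fibre of `fiberEquiv` the choice is a permutation. -/
abbrev Filling (d N t : ℕ) : Type := (Fin d → Fin (2 * N)) × Fin (t ^ (d - 1)) → Equiv.Perm (Fin t)

/-- The block that a filling chooses for the cell `(r, a)`. -/
noncomputable def Filling.label {d N t : ℕ} [NeZero d] (φ : Filling d N t) (r : Fin d → Fin (2 * N))
    (a : Fin d → Fin t) : Fin t :=
  φ (r, (fiberEquiv d t a).2) (fiberEquiv d t a).1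

lemma Filling.sum_label {d N t : ℕ} [NeZero d] (φ : Filling d N t) (r : Fin d → Fin (2 * N))
    (f : Fin t → ℝ) : ∑ a, f (φ.label r a) = (t : ℝ) ^ (d - 1) * ∑ u, f u := by
  unfold Filling.label
  rw [(fiberEquiv d t).sum_comp (fun p => f (φ (r, p.2) p.1)), Fintype.sum_prod_type_right]
  have h (m : Fin (t ^ (d - 1))) : ∑ u, f (φ (r, m) u) = ∑ u, f u := Equiv.sum_comp (φ (r, m)) f
  simp [h]

lemma Filling.exists_label_eq {d N t : ℕ} [NeZero d] (φ : Filling d N t) (r : Fin d → Fin (2 * N))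
    (u : Fin t) : ∃ a, φ.label r a = u := by
  have ht : 0 < t := Nat.lt_of_le_of_lt (Nat.zero_le _) u.2
  let m : Fin (t ^ (d - 1)) := ⟨0, by positivity⟩
  exact ⟨(fiberEquiv d t).symm ((φ (r, m)).symm u, m), by simp [Filling.label]⟩

/-- The lower corner of the block in the cell `(r, a)` of a grid. -/
def blockPos {d : ℕ} (n : ℕ) {N t : ℕ} (r : Fin d → Fin (2 * N)) (a : Fin d → Fin t) : Fin d → ℤ :=
  fun i => cellStart n (r i) (a i)

lemma blockPos_unique {d n N t : ℕ} {r r' : Fin d → Fin (2 * N)} {a a' : Fin d → Fin t}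
    {g : Fin d → ℤ} (h : g - blockPos n r a ∈ cube d n) (h' : g - blockPos n r' a' ∈ cube d n) :
    r = r' ∧ a = a' := by
  have key := fun i => cellStart_unique (h i) (h' i)
  exact ⟨funext fun i => (key i).1, funext fun i => (key i).2⟩

lemma blockPos_add_mem_cube {d n N t : ℕ} (r : Fin d → Fin (2 * N)) (a : Fin d → Fin t)
    {v : Fin d → ℤ} (hv : v ∈ cube d n) :
    blockPos n r a + v ∈ cube d (2 * N * t * (n + 1)) := by
  intro i
  have h1 := cellStart_nonneg (n := n) (r i) (a i)
  have h2 := cellStart_add_le (n := n) (r i) (a i)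
  have h3 := hv i
  simp only [Pi.add_apply, blockPos]
  omega

namespace BlockFamily

variable {C : Type*} {d : ℕ}

open Classical in
/-- The pattern obtained by writing the chosen blocks in all cells, and `c₀` elsewhere. -/
noncomputable def fill [NeZero d] (c₀ : C) (N : ℕ) (B : BlockFamily C d) (φ : Filling d N B.card)
    (g : Fin d → ℤ) : C :=
  if h : ∃ p : (Fin d → Fin (2 * N)) × (Fin d → Fin B.card),
      g - blockPos B.side p.1 p.2 ∈ cube d B.side then
    B.config (φ.label h.choose.1 h.choose.2) (g - blockPos B.side h.choose.1 h.choose.2)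
  else c₀

lemma fill_blockPos_add [NeZero d] (c₀ : C) {N : ℕ} (B : BlockFamily C d) (φ : Filling d N B.card)
    (r : Fin d → Fin (2 * N)) (a : Fin d → Fin B.card) {v : Fin d → ℤ} (hv : v ∈ cube d B.side) :
    B.fill c₀ N φ (blockPos B.side r a + v) = B.config (φ.label r a) v := by
  have hv' : blockPos B.side r a + v - blockPos B.side r a ∈ cube d B.side := by
    rwa [add_sub_cancel_left]
  have h : ∃ p : (Fin d → Fin (2 * N)) × (Fin d → Fin B.card),
      blockPos B.side r a + v - blockPos B.side p.1 p.2 ∈ cube d B.side := ⟨(r, a), hv'⟩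
  obtain ⟨h1, h2⟩ := blockPos_unique h.choose_spec hv'
  unfold fill
  rw [dif_pos h, h1, h2, add_sub_cancel_left]

/-- The family of all patterns obtained by filling the blocks of `B` into a grid of
`(2 * N * card)^d` cells of side `side + 1`. -/
noncomputable def next [NeZero d] (c₀ : C) (N : ℕ) (B : BlockFamily C d) : BlockFamily C d where
  side := 2 * N * B.card * (B.side + 1)
  card := Fintype.card (Filling d N B.card)
  config c := B.fill c₀ N ((Fintype.equivFin _).symm c)

/-- The family of all patterns on `[0, n)^d`. -/
noncomputable def full [Fintype C] (c₀ : C) (d n : ℕ) : BlockFamily C d where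
  side := n
  card := Fintype.card ((Fin d → Fin n) → C)
  config c g := if h : ∀ i, (g i).toNat < n then
    (Fintype.equivFin ((Fin d → Fin n) → C)).symm c (fun i => ⟨(g i).toNat, h i⟩) else c₀

/-- Distinct indices give distinct patterns on the cube. -/
def Separated (B : BlockFamily C d) : Prop :=
  ∀ c c', (∀ v ∈ cube d B.side, B.config c v = B.config c' v) → c = c'

lemma separated_full [Fintype C] (c₀ : C) (d n : ℕ) : (full c₀ d n).Separated := by
  intro c c' h
  apply (Fintype.equivFin ((Fin d → Fin n) → C)).symm.injective
  funext v
  have hv := h (fun i => ((v i : ℕ) : ℤ)) (fun i => ⟨by positivity, by simp [full]⟩)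
  simpa [full] using hv

lemma Separated.next [NeZero d] {B : BlockFamily C d} (hB : B.Separated) (c₀ : C) (N : ℕ) :
    (B.next c₀ N).Separated := by
  intro c c' h
  apply (Fintype.equivFin (Filling d N B.card)).symm.injective
  funext ⟨r, m⟩
  ext u : 1
  apply hB
  intro v hv
  have h1 := h _ (blockPos_add_mem_cube r ((fiberEquiv d B.card).symm (u, m)) hv)
  simp only [BlockFamily.next, fill_blockPos_add _ _ _ _ _ hv, Filling.label,
    Equiv.apply_symm_apply] at h1
  exact h1

/-! ### Larger blocks are tiled by smaller ones -/

/-- Every block of `B'` contains blocks of `B` at the points of a product set `T ^ d`, where `T`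
is a set of positions on a line that are at least `B.side` and at most `B.side + 2` apart. The
last position is flush with the right end, which makes the relation transitive. -/
def Tiles (B B' : BlockFamily C d) : Prop :=
  ∃ T : Finset ℤ,
    (∀ p ∈ T, 0 ≤ p ∧ p + B.side ≤ B'.side) ∧
    (∀ p ∈ T, ∀ q ∈ T, p < q → p + B.side ≤ q) ∧
    (∀ z : ℤ, 0 ≤ z → z < B'.side → ∃ p ∈ T, p ≤ z ∧ z < p + B.side + 2) ∧
    ((B'.side : ℤ) - B.side ∈ T) ∧
    ∀ c' : Fin B'.card, ∀ p : Fin d → ℤ, (∀ i, p i ∈ T) →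
      ∃ c : Fin B.card, ∀ v ∈ cube d B.side, B'.config c' (p + v) = B.config c v

lemma Tiles.refl (B : BlockFamily C d) : B.Tiles B := by
  refine ⟨{0}, by simp, by simp, fun z h0 h1 => ⟨0, by simp, h0, by omega⟩, by simp, ?_⟩
  intro c p hp
  have : p = 0 := funext fun i => by simpa using hp i
  exact ⟨c, fun v _ => by rw [this, zero_add]⟩

lemma Tiles.trans {B B' B'' : BlockFamily C d} (h : B.Tiles B') (h' : B'.Tiles B'') :
    B.Tiles B'' := by
  obtain ⟨T, hin, hsep, hcov, hlast, hconf⟩ := h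
  obtain ⟨T', hin', hsep', hcov', hlast', hconf'⟩ := h'
  classical
  refine ⟨Finset.image₂ (· + ·) T' T, ?_, ?_, ?_, ?_, ?_⟩
  · intro p hp
    obtain ⟨x, hx, y, hy, rfl⟩ := Finset.mem_image₂.1 hp
    have := hin _ hy
    have := hin' _ hx
    omega
  · intro p hp q hq hpq
    obtain ⟨x, hx, y, hy, rfl⟩ := Finset.mem_image₂.1 hp
    obtain ⟨x', hx', y', hy', rfl⟩ := Finset.mem_image₂.1 hq
    have h1 := hin _ hy
    have h2 := hin _ hy'
    rcases lt_trichotomy x x' with hlt | rfl | hgt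
    · have := hsep' _ hx _ hx' hlt
      omega
    · have := hsep _ hy _ hy' (by omega)
      omega
    · have := hsep' _ hx' _ hx hgt
      omega
  · intro z h0 h1
    obtain ⟨x, hx, hxz, hzx⟩ := hcov' z h0 h1
    by_cases hlt : z - x < B'.side
    · obtain ⟨y, hy, h2, h3⟩ := hcov (z - x) (by omega) hlt
      exact ⟨x + y, Finset.mem_image₂_of_mem hx hy, by omega, by omega⟩
    · exact ⟨x + (B'.side - B.side), Finset.mem_image₂_of_mem hx hlast, by omega, by omega⟩
  · have := Finset.mem_image₂_of_mem (f := (· + ·)) hlast' hlast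
    simpa using this
  · intro c'' p hp
    choose x hx y hy hxy using fun i => Finset.mem_image₂.1 (hp i)
    obtain ⟨c', hc'⟩ := hconf' c'' x hx
    obtain ⟨c, hc⟩ := hconf c' y hy
    refine ⟨c, fun v hv => ?_⟩
    have hp' : p = x + y := funext fun i => (hxy i).symm
    rw [hp', add_assoc, hc', hc v hv]
    intro i
    have := hin _ (hy i)
    have := hv i
    simp only [Pi.add_apply]
    omega

lemma tiles_next [NeZero d] (c₀ : C) {N : ℕ} (hN : 0 < N) (B : BlockFamily C d)
    (hB : 0 < B.card) : B.Tiles (B.next c₀ N) := by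
  classical
  refine ⟨Finset.univ.image fun x : Fin (2 * N) × Fin B.card => cellStart B.side x.1 x.2,
    ?_, ?_, ?_, ?_, ?_⟩
  · simp only [Finset.mem_image, Finset.mem_univ, true_and, Prod.exists, forall_exists_index]
    rintro _ r a rfl
    exact ⟨cellStart_nonneg r a, cellStart_add_le r a⟩
  · simp only [Finset.mem_image, Finset.mem_univ, true_and, Prod.exists, forall_exists_index]
    rintro _ r a rfl _ r' a' rfl hlt
    rcases lt_trichotomy ((r : ℕ) + 2 * N * (a : ℕ)) (r' + 2 * N * (a' : ℕ)) with h | h | h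
    · exact cellStart_add_le_of_lt h
    · obtain ⟨rfl, rfl⟩ := cellIndex_inj h
      exact absurd hlt (lt_irrefl _)
    · have := cellStart_add_le_of_lt (n := B.side) h
      omega
  · intro z h0 h1
    obtain ⟨r, a, h⟩ := exists_cellStart_le (n := B.side) hN h0 h1
    exact ⟨_, Finset.mem_image_of_mem _ (Finset.mem_univ (r, a)), h⟩
  · obtain ⟨r, a, h⟩ := exists_cellStart_last (n := B.side) hN hB
    exact Finset.mem_image.2 ⟨(r, a), Finset.mem_univ _, h⟩
  · intro c' p hp
    simp only [Finset.mem_image, Finset.mem_univ, true_and, Prod.exists] at hp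
    choose r a hra using hp
    have hp' : p = blockPos B.side r a := funext fun i => (hra i).symm
    exact ⟨_, fun v hv => by rw [hp']; exact fill_blockPos_add c₀ B _ r a hv⟩

end BlockFamily

/-! ### Counting occurrences of a pattern -/

/-- The indicator of the event that `g ≡ -ρ` modulo `M` and that the pattern of `w` on `P` occurs
in the configuration `y` at `g`. -/
noncomputable def hit {C : Type*} {d : ℕ} (P : Finset (Fin d → ℤ)) (w : (Fin d → ℤ) → C) (M : ℕ)
    (y : (Fin d → ℤ) → C) (ρ g : Fin d → ℤ) : ℝ :=
  open Classical in if (∀ i, (M : ℤ) ∣ g i + ρ i) ∧ ∀ u ∈ P, y (g + u) = w u then 1 else 0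

section hit

variable {C : Type*} {d : ℕ} {P : Finset (Fin d → ℤ)} {w : (Fin d → ℤ) → C} {M : ℕ}

lemma hit_nonneg (y : (Fin d → ℤ) → C) (ρ g : Fin d → ℤ) : 0 ≤ hit P w M y ρ g := by
  unfold hit; split_ifs <;> norm_num

lemma hit_le_one (y : (Fin d → ℤ) → C) (ρ g : Fin d → ℤ) : hit P w M y ρ g ≤ 1 := by
  unfold hit; split_ifs <;> norm_num

/-- Cutting out disjoint translates of a box `J` from a region `Q` changes the sum of a function
with values in `[0, 1]` by at most the number of points that are left over. -/
lemma sum_boxes_bounds {V ι : Type*} [AddCommGroup V] [DecidableEq V] {Q J : Finset V}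
    {T : Finset ι} {pos : ι → V} (hsub : ∀ p ∈ T, ∀ v ∈ J, pos p + v ∈ Q)
    (hinj : ∀ p ∈ T, ∀ p' ∈ T, ∀ v ∈ J, ∀ v' ∈ J, pos p + v = pos p' + v' → p = p')
    {f : V → ℝ} (h0 : ∀ v, 0 ≤ f v) (h1 : ∀ v, f v ≤ 1) :
    ∑ p ∈ T, ∑ v ∈ J, f (pos p + v) ≤ ∑ g ∈ Q, f g ∧
      ∑ g ∈ Q, f g ≤ ∑ p ∈ T, ∑ v ∈ J, f (pos p + v) + ((Q.card : ℝ) - T.card * J.card) := by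
  have hinj' : Set.InjOn (fun x : ι × V => pos x.1 + x.2) (T ×ˢ J : Finset (ι × V)) := by
    rintro ⟨p, v⟩ hx ⟨p', v'⟩ hx' h
    simp only [Finset.coe_product, Set.mem_prod, Finset.mem_coe] at hx hx'
    obtain rfl := hinj p hx.1 p' hx'.1 v hx.2 v' hx'.2 h
    simpa using h
  set S := (T ×ˢ J).image fun x : ι × V => pos x.1 + x.2 with hS
  have hSQ : S ⊆ Q := by
    intro g hg
    obtain ⟨x, hx, rfl⟩ := Finset.mem_image.1 hg
    rw [Finset.mem_product] at hx
    exact hsub _ hx.1 _ hx.2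
  have hsum : ∑ g ∈ S, f g = ∑ p ∈ T, ∑ v ∈ J, f (pos p + v) := by
    rw [hS, Finset.sum_image hinj', Finset.sum_product]
  have hcard : S.card = T.card * J.card := by
    rw [hS, Finset.card_image_of_injOn hinj', Finset.card_product]
  rw [← hsum]
  refine ⟨Finset.sum_le_sum_of_subset_of_nonneg hSQ fun _ _ _ => h0 _, ?_⟩
  rw [← Finset.sum_sdiff hSQ, add_comm]
  gcongr
  calc ∑ g ∈ Q \ S, f g ≤ ∑ _g ∈ Q \ S, (1 : ℝ) := Finset.sum_le_sum fun _ _ => h1 _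
    _ = (Q.card : ℝ) - T.card * J.card := by
      rw [Finset.sum_const, nsmul_one, Finset.cast_card_sdiff hSQ, hcard]
      push_cast; ring

/-- The points of `[0, n)^d` at distance at least `m` from the outside. -/
noncomputable def innerBox (d m n : ℕ) : Finset (Fin d → ℤ) :=
  Fintype.piFinset fun _ => Finset.Ico (m : ℤ) (n - m)

lemma mem_innerBox {m n : ℕ} {v : Fin d → ℤ} :
    v ∈ innerBox d m n ↔ ∀ i, (m : ℤ) ≤ v i ∧ v i < n - m := by
  simp [innerBox]

lemma card_innerBox {m n : ℕ} (h : 2 * m ≤ n) :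
    ((innerBox d m n).card : ℝ) = ((n : ℝ) - 2 * m) ^ d := by
  have h1 : ((n : ℤ) - m - m).toNat = n - 2 * m := by omega
  simp only [innerBox, Fintype.card_piFinset, Int.card_Ico, Finset.prod_const, Finset.card_univ,
    Fintype.card_fin, h1]
  push_cast [Nat.cast_sub h]
  rfl

lemma innerBox_subset_cube {m n : ℕ} {v : Fin d → ℤ} (hv : v ∈ innerBox d m n) : v ∈ cube d n := by
  intro i
  have := mem_innerBox.1 hv i
  omega

lemma innerBox_add_mem_cube {m n : ℕ} (hP : ∀ u ∈ P, ∀ i, |u i| ≤ m) {v u : Fin d → ℤ}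
    (hv : v ∈ innerBox d m n) (hu : u ∈ P) : v + u ∈ cube d n := by
  intro i
  have h1 := mem_innerBox.1 hv i
  have h2 := abs_le.1 (hP u hu i)
  simp only [Pi.add_apply]
  omega

lemma hit_add {y y' : (Fin d → ℤ) → C} {m n : ℕ} (hP : ∀ u ∈ P, ∀ i, |u i| ≤ m) {p : Fin d → ℤ}
    (hy : ∀ v ∈ cube d n, y (p + v) = y' v) {v : Fin d → ℤ} (hv : v ∈ innerBox d m n)
    (ρ : Fin d → ℤ) : hit P w M y ρ (p + v) = hit P w M y' (ρ + p) v := by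
  have h1 : (∀ u ∈ P, y (p + v + u) = w u) ↔ ∀ u ∈ P, y' (v + u) = w u := by
    refine forall₂_congr fun u hu => ?_
    rw [add_assoc, hy _ (innerBox_add_mem_cube hP hv hu)]
  have h2 : (∀ i, (M : ℤ) ∣ (p + v) i + ρ i) ↔ ∀ i, (M : ℤ) ∣ v i + (ρ + p) i := by
    refine forall_congr' fun i => ?_
    rw [show (p + v) i + ρ i = v i + (ρ + p) i by simp only [Pi.add_apply]; ring]
  unfold hit
  split_ifs with a b b
  · rfl
  · exact absurd ⟨h2.1 a.1, h1.1 a.2⟩ b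
  · exact absurd ⟨h2.2 b.1, h1.2 b.2⟩ a
  · rfl

/-- The starting points `r + r / N` of the blocks are equidistributed modulo `M`. -/
lemma exists_sum_cell_dvd {N : ℕ} (hMN : M ∣ N) (hN : 0 < N) :
    ∃ K : ℝ, 0 ≤ K ∧ ∀ z : ℤ,
      ∑ r : Fin (2 * N), (if (M : ℤ) ∣ z + ((r : ℕ) + ((r : ℕ) / N : ℕ) : ℤ) then (1 : ℝ) else 0)
        = K := by
  have hM : 0 < M := Nat.pos_of_dvd_of_pos hMN hN
  have key (z : ℤ) : ∑ r ∈ Finset.range N, (if (M : ℤ) ∣ z + (r : ℕ) then (1 : ℝ) else 0) =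
      N.count (M ∣ ·) := by
    obtain ⟨b, hb⟩ : ∃ b : ℕ, (M : ℤ) ∣ z - b := by
      refine ⟨(z % M).toNat, ?_⟩
      rw [Int.toNat_of_nonneg (Int.emod_nonneg _ (by omega))]
      exact Int.dvd_self_sub_emod
    have h1 (r : ℕ) : (M : ℤ) ∣ z + (r : ℕ) ↔ M ∣ b + r := by
      rw [show z + (r : ℤ) = (z - b) + ((b + r : ℕ) : ℤ) by push_cast; ring,
        dvd_add_right hb, Int.natCast_dvd_natCast]
    simp only [h1]
    have h2 := Nat.filter_Ico_card_eq_of_periodic b N (M ∣ ·) (fun r => by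
      simp only [eq_iff_iff]; exact (Nat.dvd_add_left hMN))
    rw [← h2, Finset.card_filter, Finset.sum_Ico_eq_sum_range]
    simp
  refine ⟨2 * N.count (M ∣ ·), by positivity, fun z => ?_⟩
  rw [Fin.sum_univ_eq_sum_range (fun r : ℕ => if (M : ℤ) ∣ z + ((r : ℤ) + ((r / N : ℕ) : ℤ)) then
    (1 : ℝ) else 0) (2 * N), two_mul, two_mul, Finset.sum_range_add]
  congr 1
  · rw [← key z]
    refine Finset.sum_congr rfl fun r hr => ?_
    rw [Nat.div_eq_of_lt (Finset.mem_range.1 hr)]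
    simp
  · rw [← key (z + N + 1)]
    refine Finset.sum_congr rfl fun r hr => ?_
    have : (N + r) / N = 1 := by
      rw [Nat.add_div_left _ hN, Nat.div_eq_of_lt (Finset.mem_range.1 hr)]
    rw [this, show z + (((N + r : ℕ) : ℤ) + ((1 : ℕ) : ℤ)) = z + N + 1 + (r : ℕ) by push_cast; ring]

lemma dvd_add_cellStart_iff {n N t : ℕ} (hMN : M ∣ N) (hMn : M ∣ n) (r : Fin (2 * N)) (a : Fin t)
    (z : ℤ) : (M : ℤ) ∣ z + cellStart n r a ↔
      (M : ℤ) ∣ z + ((r : ℕ) + ((r : ℕ) / N : ℕ) : ℤ) := by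
  obtain ⟨b, rfl⟩ := hMN
  obtain ⟨c, rfl⟩ := hMn
  have : z + cellStart (M * c) r a = z + ((r : ℕ) + ((r : ℕ) / (M * b) : ℕ) : ℤ) +
      M * (((r : ℕ) + 2 * (M * b : ℕ) * (a : ℕ)) * c + 2 * b * (a : ℕ)) := by
    unfold cellStart; push_cast; ring
  rw [this]
  exact dvd_add_left (dvd_mul_right _ _)

end hit

namespace BlockFamily

variable {C : Type*} {d : ℕ}

/-- The number of occurrences of a pattern in the inner part of a block, at positions in a given
residue class modulo `M`. -/
noncomputable def count (B : BlockFamily C d) (P : Finset (Fin d → ℤ)) (w : (Fin d → ℤ) → C)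
    (M m : ℕ) (c : Fin B.card) (ρ : Fin d → ℤ) : ℝ :=
  ∑ v ∈ innerBox d m B.side, hit P w M (B.config c) ρ v

/-- In the blocks of the next family, every block of `B` occurs equally often in each class of
cells, and the positions of these classes are equidistributed modulo `M`. Hence the count of a
pattern depends on the block and the residue class only through the occurrences that are not
inside one of the smaller blocks. -/
lemma exists_count_next_bounds [NeZero d] (c₀ : C) {N M m : ℕ} (B : BlockFamily C d)
    (hN : 0 < N) (hB : 0 < B.card) (hMN : M ∣ N) (hMn : M ∣ B.side) (hm : 2 * m ≤ B.side)
    {P : Finset (Fin d → ℤ)} (w : (Fin d → ℤ) → C) (hP : ∀ u ∈ P, ∀ i, |u i| ≤ m) :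
    ∃ H : ℝ, 0 ≤ H ∧ ∀ c ρ, H ≤ (B.next c₀ N).count P w M m c ρ ∧
      (B.next c₀ N).count P w M m c ρ ≤ H + ((((B.next c₀ N).side : ℝ) - 2 * m) ^ d -
        (2 * N * B.card * ((B.side : ℝ) - 2 * m)) ^ d) := by
  classical
  obtain ⟨K, hK0, hK⟩ := exists_sum_cell_dvd hMN hN
  let pat (u : Fin B.card) (v : Fin d → ℤ) : ℝ := if ∀ x ∈ P, B.config u (v + x) = w x then 1 else 0
  have hpat (u v) : 0 ≤ pat u v := by simp only [pat]; split_ifs <;> norm_num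
  refine ⟨(B.card : ℝ) ^ (d - 1) * ∑ u, ∑ v ∈ innerBox d m B.side, pat u v * K ^ d,
    mul_nonneg (by positivity) (Finset.sum_nonneg fun u _ => Finset.sum_nonneg fun v _ =>
      mul_nonneg (hpat u v) (pow_nonneg hK0 d)), ?_⟩
  intro c ρ
  set φ := (Fintype.equivFin (Filling d N B.card)).symm c with hφ
  have hmain : ∑ x : (Fin d → Fin (2 * N)) × (Fin d → Fin B.card), ∑ v ∈ innerBox d m B.side,
      hit P w M ((B.next c₀ N).config c) ρ (blockPos B.side x.1 x.2 + v) =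
      (B.card : ℝ) ^ (d - 1) * ∑ u, ∑ v ∈ innerBox d m B.side, pat u v * K ^ d := by
    have hterm (x : (Fin d → Fin (2 * N)) × (Fin d → Fin B.card)) (v)
        (hv : v ∈ innerBox d m B.side) :
        hit P w M ((B.next c₀ N).config c) ρ (blockPos B.side x.1 x.2 + v) =
        pat (φ.label x.1 x.2) v * ∏ i, if (M : ℤ) ∣ (v i + ρ i) +
          ((x.1 i : ℕ) + ((x.1 i : ℕ) / N : ℕ) : ℤ) then (1 : ℝ) else 0 := by
      have hfill : ∀ v ∈ cube d B.side, (B.next c₀ N).config c (blockPos B.side x.1 x.2 + v) =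
          B.config (φ.label x.1 x.2) v := fun v hv => fill_blockPos_add c₀ B φ x.1 x.2 hv
      rw [hit_add hP hfill hv, hit, Finset.prod_boole]
      have h2 : (∀ i, (M : ℤ) ∣ v i + (ρ + blockPos B.side x.1 x.2) i) ↔
          ∀ i ∈ Finset.univ, (M : ℤ) ∣ (v i + ρ i) +
            ((x.1 i : ℕ) + ((x.1 i : ℕ) / N : ℕ) : ℤ) := by
        simp only [Finset.mem_univ, true_imp_iff]
        refine forall_congr' fun i => ?_
        rw [← dvd_add_cellStart_iff hMN hMn (x.1 i) (x.2 i), Pi.add_apply, add_assoc]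
        rfl
      by_cases hA : ∀ y ∈ P, B.config (φ.label x.1 x.2) (v + y) = w y
      · rw [show pat (φ.label x.1 x.2) v = 1 from if_pos hA, one_mul]
        by_cases hd : ∀ i ∈ Finset.univ, (M : ℤ) ∣ (v i + ρ i) +
            ((x.1 i : ℕ) + ((x.1 i : ℕ) / N : ℕ) : ℤ)
        · rw [if_pos hd, if_pos ⟨h2.2 hd, hA⟩]
        · rw [if_neg hd, if_neg fun h => hd (h2.1 h.1)]
      · rw [show pat (φ.label x.1 x.2) v = 0 from if_neg hA, zero_mul]
        exact if_neg fun h => hA h.2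
    rw [Finset.sum_congr rfl fun x _ => Finset.sum_congr rfl (hterm x), Fintype.sum_prod_type]
    simp only
    have hsum (r : Fin d → Fin (2 * N)) := φ.sum_label r fun u => ∑ v ∈ innerBox d m B.side,
      pat u v * ∏ i, if (M : ℤ) ∣ (v i + ρ i) +
          ((r i : ℕ) + ((r i : ℕ) / N : ℕ) : ℤ) then (1 : ℝ) else 0
    rw [Finset.sum_congr rfl fun r _ => hsum r, ← Finset.mul_sum, Finset.sum_comm]
    congr 1
    refine Finset.sum_congr rfl fun u _ => ?_
    rw [Finset.sum_comm]
    refine Finset.sum_congr rfl fun v _ => ?_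
    rw [← Finset.mul_sum]
    congr 1
    have hprod := Finset.prod_univ_sum (fun _ : Fin d => (Finset.univ : Finset (Fin (2 * N))))
      (fun i r => if (M : ℤ) ∣ (v i + ρ i) +
          ((r : ℕ) + ((r : ℕ) / N : ℕ) : ℤ) then (1 : ℝ) else 0)
    rw [Fintype.piFinset_univ] at hprod
    rw [← hprod, Finset.prod_congr rfl fun i _ => hK (v i + ρ i)]
    simp
  have hside : 2 * m ≤ (B.next c₀ N).side := by
    have : 1 * B.side ≤ 2 * N * B.card * (B.side + 1) :=
      Nat.mul_le_mul (Nat.mul_pos (by omega) hB) (Nat.le_succ _)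
    simp only [next]; omega
  have hbox := sum_boxes_bounds (Q := innerBox d m (B.next c₀ N).side) (J := innerBox d m B.side)
    (T := Finset.univ) (pos := fun x : (Fin d → Fin (2 * N)) × (Fin d → Fin B.card) =>
      blockPos B.side x.1 x.2) (f := hit P w M ((B.next c₀ N).config c) ρ)
    (fun x _ v hv => ?_) (fun x _ x' _ v hv v' hv' h => ?_) (hit_nonneg _ _) (hit_le_one _ _)
  · rw [hmain, card_innerBox hside, card_innerBox hm, Finset.card_univ, Fintype.card_prod,
      Fintype.card_fun, Fintype.card_fun, Fintype.card_fin, Fintype.card_fin,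
      Fintype.card_fin] at hbox
    refine ⟨hbox.1, hbox.2.trans (le_of_eq ?_)⟩
    push_cast
    simp only [mul_pow]
  · rw [mem_innerBox] at hv ⊢
    intro i
    have h1 := cellStart_nonneg (n := B.side) (x.1 i) (x.2 i)
    have h2 := cellStart_add_le (n := B.side) (x.1 i) (x.2 i)
    have h3 := hv i
    simp only [Pi.add_apply, blockPos, next]
    omega
  · have e := blockPos_unique (g := blockPos B.side x.1 x.2 + v) (r := x.1) (a := x.2) (r' := x'.1)
      (a' := x'.2) (n := B.side) (by rw [add_sub_cancel_left]; exact innerBox_subset_cube hv)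
      (by rw [h, add_sub_cancel_left]; exact innerBox_subset_cube hv')
    exact Prod.ext e.1 e.2

end BlockFamily

/-! ### Occurrences in windows -/

lemma exists_abs_le_of_finset {d : ℕ} (P : Finset (Fin d → ℤ)) :
    ∃ b : ℕ, ∀ g ∈ P, ∀ i, |g i| ≤ b := by
  refine ⟨P.sup fun g => Finset.univ.sup fun i => (g i).natAbs, fun g hg i => ?_⟩
  have h1 : (g i).natAbs ≤ Finset.univ.sup fun i => (g i).natAbs :=
    Finset.le_sup (f := fun i => (g i).natAbs) (Finset.mem_univ i)
  have h2 := h1.trans (Finset.le_sup (f := fun g : Fin d → ℤ =>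
    Finset.univ.sup fun i => (g i).natAbs) hg)
  rw [Int.abs_eq_natAbs]
  exact_mod_cast h2

namespace BlockFamily

variable {C : Type*} {d : ℕ}

/-- The blocks that lie in a window of length `L` on a line are numerous. -/
lemma le_card_filter_window {T : Finset ℤ} {n n' L : ℕ} {a : ℤ}
    (hcov : ∀ z : ℤ, 0 ≤ z → z < n' → ∃ p ∈ T, p ≤ z ∧ z < p + n + 2) (ha : 0 ≤ a)
    (haL : a + L ≤ n') :
    (L : ℝ) / (n + 2) - 2 ≤ (T.filter fun p => a ≤ p ∧ p + n ≤ a + L).card := by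
  set R := T.filter fun p => a ≤ p ∧ p + n ≤ a + L with hR
  have hsub : Finset.Ico (a + (n + 2)) (a + L - (n + 2)) ⊆
      R.biUnion fun p => Finset.Ico p (p + (n + 2)) := by
    intro z hz
    rw [Finset.mem_Ico] at hz
    obtain ⟨p, hp, h1, h2⟩ := hcov z (by omega) (by omega)
    rw [Finset.mem_biUnion]
    refine ⟨p, ?_, Finset.mem_Ico.2 ⟨h1, by omega⟩⟩
    rw [hR, Finset.mem_filter]
    exact ⟨hp, by omega, by omega⟩
  have h1 := (Finset.card_le_card hsub).trans
    (Finset.card_biUnion_le_card_mul R _ (n + 2) fun p _ => by simp only [Int.card_Ico]; omega)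
  rw [Int.card_Ico] at h1
  have h2 : L ≤ R.card * (n + 2) + 2 * (n + 2) := by omega
  have h3 : (L : ℝ) ≤ R.card * (n + 2) + 2 * (n + 2) := by exact_mod_cast h2
  rw [sub_le_iff_le_add, div_le_iff₀ (by positivity)]
  linarith

/-- If the counts of a pattern in the blocks of `B` are all close to `H`, then the number of its
occurrences in any window of a configuration tiled by such blocks is close to `H` times the number
`R` of blocks inside the window. -/
lemma Tiles.window_bounds {B B' : BlockFamily C d} (h : B.Tiles B') {P : Finset (Fin d → ℤ)}
    {w : (Fin d → ℤ) → C} {M m L : ℕ} (hP : ∀ u ∈ P, ∀ i, |u i| ≤ m) (hm : 2 * m ≤ B.side)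
    {H e : ℝ} (hcount : ∀ c ρ, H ≤ B.count P w M m c ρ ∧ B.count P w M m c ρ ≤ H + e)
    (c' : Fin B'.card) {a : Fin d → ℤ} (ha : ∀ i, 0 ≤ a i ∧ a i + L ≤ B'.side)
    (hL : 2 * (B.side + 2) ≤ L) (ρ : Fin d → ℤ) :
    ∃ R : ℝ, ((L : ℝ) / (B.side + 2) - 2) ^ d ≤ R ∧ R * ((B.side : ℝ) - 2 * m) ^ d ≤ (L : ℝ) ^ d ∧
      R * H ≤ ∑ v ∈ innerBox d 0 L, hit P w M (B'.config c') ρ (a + v) ∧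
      ∑ v ∈ innerBox d 0 L, hit P w M (B'.config c') ρ (a + v) ≤
        R * (H + e) + ((L : ℝ) ^ d - R * ((B.side : ℝ) - 2 * m) ^ d) := by
  classical
  obtain ⟨T, hin, hsep, hcov, -, hconf⟩ := h
  let R (i : Fin d) : Finset ℤ := T.filter fun p => a i ≤ p ∧ p + B.side ≤ a i + L
  have hR {p : Fin d → ℤ} (hp : p ∈ Fintype.piFinset R) (i : Fin d) :
      p i ∈ T ∧ a i ≤ p i ∧ p i + B.side ≤ a i + L :=
    Finset.mem_filter.1 (Fintype.mem_piFinset.1 hp i)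
  have hunique {p p' : Fin d → ℤ} (hp : p ∈ Fintype.piFinset R) (hp' : p' ∈ Fintype.piFinset R)
      {v v' : Fin d → ℤ} (hv : v ∈ cube d B.side) (hv' : v' ∈ cube d B.side)
      (heq : p - a + v = p' - a + v') : p = p' := by
    funext i
    have h1 := congrFun heq i
    simp only [Pi.add_apply, Pi.sub_apply] at h1
    have h2 := hv i
    have h3 := hv' i
    rcases lt_trichotomy (p i) (p' i) with hlt | heq | hgt
    · have := hsep _ (hR hp i).1 _ (hR hp' i).1 hlt; omega
    · exact heq
    · have := hsep _ (hR hp' i).1 _ (hR hp i).1 hgt; omega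
  have hbox := sum_boxes_bounds (Q := innerBox d 0 L) (J := innerBox d m B.side)
    (T := Fintype.piFinset R) (pos := fun p => p - a)
    (f := fun v => hit P w M (B'.config c') ρ (a + v))
    (fun p hp v hv => by
      rw [mem_innerBox] at hv ⊢
      intro i
      have h1 := hR hp i
      have h2 := hv i
      simp only [Pi.add_apply, Pi.sub_apply]
      omega)
    (fun p hp p' hp' v hv v' hv' heq =>
      hunique hp hp' (innerBox_subset_cube hv) (innerBox_subset_cube hv') heq)
    (fun _ => hit_nonneg _ _ _) (fun _ => hit_le_one _ _ _)
  have hvol := sum_boxes_bounds (Q := innerBox d 0 L) (J := innerBox d m B.side)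
    (T := Fintype.piFinset R) (pos := fun p => p - a) (f := fun _ => 1)
    (fun p hp v hv => by
      rw [mem_innerBox] at hv ⊢
      intro i
      have h1 := hR hp i
      have h2 := hv i
      simp only [Pi.add_apply, Pi.sub_apply]
      omega)
    (fun p hp p' hp' v hv v' hv' heq =>
      hunique hp hp' (innerBox_subset_cube hv) (innerBox_subset_cube hv') heq)
    (fun _ => zero_le_one) (fun _ => le_rfl)
  have hsum : ∀ p ∈ Fintype.piFinset R, H ≤ ∑ v ∈ innerBox d m B.side,
        hit P w M (B'.config c') ρ (a + (p - a + v)) ∧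
      ∑ v ∈ innerBox d m B.side, hit P w M (B'.config c') ρ (a + (p - a + v)) ≤ H + e := by
    intro p hp
    obtain ⟨c, hc⟩ := hconf c' p fun i => (hR hp i).1
    have : ∑ v ∈ innerBox d m B.side, hit P w M (B'.config c') ρ (a + (p - a + v)) =
        B.count P w M m c (ρ + p) := by
      refine Finset.sum_congr rfl fun v hv => ?_
      rw [← add_assoc, add_sub_cancel, hit_add hP hc hv]
    rw [this]
    exact hcount _ _
  have hcardL : ((innerBox d 0 L).card : ℝ) = (L : ℝ) ^ d := by
    rw [card_innerBox (by omega)]; simp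
  have hcardJ := card_innerBox (d := d) hm
  rw [hcardL, hcardJ] at hbox
  simp only [Finset.sum_const, nsmul_eq_mul, mul_one, hcardL, hcardJ] at hvol
  refine ⟨((Fintype.piFinset R).card : ℝ), ?_, hvol.1, ?_, ?_⟩
  · rw [Fintype.card_piFinset]
    push_cast
    calc ((L : ℝ) / (B.side + 2) - 2) ^ d = ∏ _i : Fin d, ((L : ℝ) / (B.side + 2) - 2) := by simp
      _ ≤ ∏ i, ((R i).card : ℝ) := by
        refine Finset.prod_le_prod (fun _ _ => ?_) fun i _ =>
          le_card_filter_window hcov (ha i).1 (ha i).2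
        rw [sub_nonneg, le_div_iff₀ (by positivity)]
        exact_mod_cast hL
  · refine le_trans ?_ hbox.1
    rw [← nsmul_eq_mul]
    exact Finset.card_nsmul_le_sum _ _ _ fun p hp => (hsum p hp).1
  · refine hbox.2.trans (add_le_add_left ?_ _)
    rw [← nsmul_eq_mul]
    exact Finset.sum_le_card_nsmul _ _ _ fun p hp => (hsum p hp).2

/-- In every sufficiently large window there is a complete block. -/
lemma Tiles.exists_block_in_window {B B' : BlockFamily C d} (h : B.Tiles B') (c' : Fin B'.card)
    {a : Fin d → ℤ} (ha : ∀ i, 0 ≤ a i ∧ a i + (2 * B.side + 2 : ℕ) ≤ B'.side) :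
    ∃ (p : Fin d → ℤ) (c : Fin B.card), (∀ i, 0 ≤ p i ∧ p i ≤ B.side + 2) ∧
      ∀ v ∈ cube d B.side, B'.config c' (a + p + v) = B.config c v := by
  obtain ⟨T, hin, hsep, hcov, -, hconf⟩ := h
  have hex (i : Fin d) : ∃ p ∈ T, p ≤ a i + B.side + 1 ∧ a i + B.side + 1 < p + B.side + 2 :=
    hcov _ (by have := ha i; omega) (by have := ha i; omega)
  choose p hpT hp1 hp2 using hex
  obtain ⟨c, hc⟩ := hconf c' p hpT
  refine ⟨p - a, c, fun i => ?_, fun v hv => ?_⟩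
  · have h1 := hp1 i
    have h2 := hp2 i
    simp only [Pi.sub_apply]
    omega
  · rw [add_sub_cancel, hc v hv]

/-! ### The subshift generated by the blocks -/

/-- Sets that depend on finitely many coordinates are closed. -/
lemma isClosed_of_forall_eqOn [TopologicalSpace C] [DiscreteTopology C]
    {A : Set ((Fin d → ℤ) → C)} (S : Finset (Fin d → ℤ))
    (h : ∀ x ∈ A, ∀ y, (∀ g ∈ S, y g = x g) → y ∈ A) : IsClosed A := by
  rw [← isOpen_compl_iff, isOpen_iff_mem_nhds]
  intro x hx
  refine Filter.mem_of_superset ((isOpen_cylinder S x).mem_nhds fun _ _ => rfl) fun y hy hyA => ?_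
  exact hx (h y hyA x fun g hg => (hy g hg).symm)

variable [NeZero d] [Fintype C]

/-- The blocks of the construction: all patterns on `[0, n₀)^d` at level `0`, and at each level the
fillings by blocks of the level before, with multiplicities controlled modulo `(k + 1)!`. -/
noncomputable def level (c₀ : C) (d : ℕ) [NeZero d] (n₀ : ℕ) : ℕ → BlockFamily C d
  | 0 => full c₀ d n₀
  | k + 1 => (level c₀ d n₀ k).next c₀ (k + 1).factorial

variable (c₀ : C) (n₀ : ℕ)

lemma card_level_pos (k : ℕ) : 0 < (level c₀ d n₀ k).card := by
  cases k with
  | zero =>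
    have : Nonempty C := ⟨c₀⟩
    exact Fintype.card_pos
  | succ k => exact Fintype.card_pos

lemma separated_level (k : ℕ) : (level c₀ d n₀ k).Separated := by
  induction k with
  | zero => exact separated_full _ _ _
  | succ k ih => exact ih.next _ _

lemma tiles_level {k K : ℕ} (h : k ≤ K) : (level c₀ d n₀ k).Tiles (level c₀ d n₀ K) := by
  induction K, h using Nat.le_induction with
  | base => exact Tiles.refl _
  | succ K _ ih => exact ih.trans (tiles_next c₀ (Nat.factorial_pos _) _ (card_level_pos _ _ _))

lemma two_mul_side_level_lt (k : ℕ) :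
    2 * (level c₀ d n₀ k).side < (level c₀ d n₀ (k + 1)).side := by
  have h : 2 * 1 * 1 * ((level c₀ d n₀ k).side + 1) ≤
      2 * (k + 1).factorial * (level c₀ d n₀ k).card * ((level c₀ d n₀ k).side + 1) := by
    gcongr
    · exact Nat.factorial_pos _
    · exact card_level_pos _ _ _
  simp only [level, next]
  omega

lemma two_pow_mul_le_side_level (k : ℕ) : 2 ^ k * n₀ ≤ (level c₀ d n₀ k).side := by
  induction k with
  | zero => simp [level, full]
  | succ k ih =>
    have := two_mul_side_level_lt (d := d) c₀ n₀ k
    rw [pow_succ]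
    nlinarith

lemma le_side_level (k : ℕ) : k ≤ (level c₀ d n₀ k).side := by
  induction k with
  | zero => simp
  | succ k ih =>
    have := two_mul_side_level_lt (d := d) c₀ n₀ k
    omega

lemma dvd_side_level {M k : ℕ} (hM : 0 < M) (h : M ≤ k) : M ∣ (level c₀ d n₀ k).side := by
  obtain ⟨j, rfl⟩ : ∃ j, k = j + 1 := ⟨k - 1, by omega⟩
  have : M ∣ (j + 1).factorial := Nat.dvd_factorial hM h
  simp only [level, next]
  exact ((this.mul_left 2).mul_right _).mul_right _

/-- The configurations all of whose finite patterns occur in blocks of arbitrarily high level. -/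
def limitSet (c₀ : C) (d : ℕ) [NeZero d] (n₀ : ℕ) : Set ((Fin d → ℤ) → C) :=
  {x | ∀ (S : Finset (Fin d → ℤ)) (k : ℕ), ∃ K ≥ k, ∃ (c : Fin (level c₀ d n₀ K).card)
    (p : Fin d → ℤ), ∀ g ∈ S, p + g ∈ cube d (level c₀ d n₀ K).side ∧
      x g = (level c₀ d n₀ K).config c (p + g)}

lemma isClosed_limitSet_aux [TopologicalSpace C] [DiscreteTopology C]
    (S : Finset (Fin d → ℤ)) (k : ℕ) : IsClosed {x : (Fin d → ℤ) → C |
      ∃ K ≥ k, ∃ (c : Fin (level c₀ d n₀ K).card) (p : Fin d → ℤ), ∀ g ∈ S,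
        p + g ∈ cube d (level c₀ d n₀ K).side ∧ x g = (level c₀ d n₀ K).config c (p + g)} := by
  refine isClosed_of_forall_eqOn S ?_
  rintro x ⟨K, hK, c, p, hx⟩ y hy
  exact ⟨K, hK, c, p, fun g hg => ⟨(hx g hg).1, (hy g hg).trans (hx g hg).2⟩⟩

/-- The subshift generated by the blocks. -/
def limitShift [TopologicalSpace C] [DiscreteTopology C] (c₀ : C) (d : ℕ) [NeZero d] (n₀ : ℕ) :
    Subshift C (Fin d → ℤ) where
  carrier := limitSet c₀ d n₀
  isClosed := by
    simp only [limitSet, Set.ofPred_forall]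
    exact isClosed_iInter fun S => isClosed_iInter fun k => isClosed_limitSet_aux c₀ n₀ S k
  mapsTo := by
    classical
    intro g x hx S k
    obtain ⟨K, hK, c, p, h⟩ := hx (S.image (g + ·)) k
    refine ⟨K, hK, c, p + g, fun v hv => ?_⟩
    rw [add_assoc]
    exact h _ (Finset.mem_image_of_mem _ hv)

lemma limitSet_nonempty [TopologicalSpace C] [DiscreteTopology C] :
    (limitSet c₀ d n₀).Nonempty := by
  classical
  let Z (j : Finset (Fin d → ℤ) × ℕ) : Set ((Fin d → ℤ) → C) := {x |
      ∃ K ≥ j.2, ∃ (c : Fin (level c₀ d n₀ K).card) (p : Fin d → ℤ), ∀ g ∈ j.1,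
        p + g ∈ cube d (level c₀ d n₀ K).side ∧ x g = (level c₀ d n₀ K).config c (p + g)}
  have hmono {j j' : Finset (Fin d → ℤ) × ℕ} (h : j ≤ j') : Z j' ⊆ Z j := by
    rintro x ⟨K, hK, c, p, hx⟩
    exact ⟨K, h.2.trans hK, c, p, fun g hg => hx g (h.1 hg)⟩
  have hne (j) : (Z j).Nonempty := by
    obtain ⟨b, hb⟩ := exists_abs_le_of_finset j.1
    refine ⟨fun g => (level c₀ d n₀ (j.2 + 2 * b + 1)).config ⟨0, card_level_pos _ _ _⟩
      ((fun _ => (b : ℤ)) + g), j.2 + 2 * b + 1, by omega, _, _, fun g hg => ⟨fun i => ?_, rfl⟩⟩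
    have h1 := le_side_level (d := d) c₀ n₀ (j.2 + 2 * b + 1)
    have h2 := abs_le.1 (hb g hg i)
    simp only [Pi.add_apply]
    omega
  have hZ := IsCompact.nonempty_iInter_of_directed_nonempty_isCompact_isClosed Z
    (fun j j' => ⟨j ⊔ j', hmono le_sup_left, hmono le_sup_right⟩) hne
    (fun j => (isClosed_limitSet_aux c₀ n₀ j.1 j.2).isCompact)
    (fun j => isClosed_limitSet_aux c₀ n₀ j.1 j.2)
  obtain ⟨x, hx⟩ := hZ
  exact ⟨x, fun S k => Set.mem_iInter.1 hx (S, k)⟩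

variable {c₀ n₀}

lemma exists_block_of_mem_limitSet {x : (Fin d → ℤ) → C} (hx : x ∈ limitSet c₀ d n₀) (k : ℕ) :
    ∃ (p : Fin d → ℤ) (c : Fin (level c₀ d n₀ k).card),
      ∀ v ∈ cube d (level c₀ d n₀ k).side, x (p + v) = (level c₀ d n₀ k).config c v := by
  set n := (level c₀ d n₀ k).side with hn
  obtain ⟨K, hK, c', a, ha⟩ := hx (innerBox d 0 (2 * n + 2)) k
  have hend (i : Fin d) : 0 ≤ a i ∧ a i + (2 * n + 2 : ℕ) ≤ (level c₀ d n₀ K).side := by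
    have h1 := (ha (fun _ => 0) (mem_innerBox.2 fun i => by simp; omega)).1 i
    have h2 := (ha (fun _ => 2 * n + 1) (mem_innerBox.2 fun i => by simp; omega)).1 i
    simp only [Pi.add_apply] at h1 h2
    omega
  obtain ⟨p, c, hp, hc⟩ := (tiles_level c₀ n₀ hK).exists_block_in_window c' hend
  refine ⟨p, c, fun v hv => ?_⟩
  rw [← hc v hv, add_assoc]
  refine (ha _ (mem_innerBox.2 fun i => ?_)).2
  have h1 := hp i
  have h2 := hv i
  simp only [Pi.add_apply]
  omega

/-- Every block occurs in every configuration of the subshift, in every residue class. -/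
lemma exists_block_eq_of_mem_limitSet {x : (Fin d → ℤ) → C} (hx : x ∈ limitSet c₀ d n₀) {M k : ℕ}
    (hM : 0 < M) (hk : M ≤ k) (c : Fin (level c₀ d n₀ k).card) (ρ : Fin d → ℤ) :
    ∃ p : Fin d → ℤ, (∀ i, (M : ℤ) ∣ ρ i + p i) ∧
      ∀ v ∈ cube d (level c₀ d n₀ k).side, x (p + v) = (level c₀ d n₀ k).config c v := by
  obtain ⟨p, c', hp⟩ := exists_block_of_mem_limitSet hx (k + 1)
  have hMN : M ∣ (k + 1).factorial := Nat.dvd_factorial hM (by omega)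
  have hr (i : Fin d) : ∃ r : Fin (2 * (k + 1).factorial), (M : ℤ) ∣ (ρ i + p i) +
      ((r : ℕ) + ((r : ℕ) / (k + 1).factorial : ℕ) : ℤ) := by
    have h0 := Int.emod_nonneg (-(ρ i + p i)) (b := (M : ℤ)) (by omega)
    have h1 := Int.emod_lt_of_pos (-(ρ i + p i)) (b := (M : ℤ)) (by omega)
    have h2 := Nat.le_of_dvd (Nat.factorial_pos _) hMN
    refine ⟨⟨(-(ρ i + p i) % M).toNat, by omega⟩, ?_⟩
    rw [Nat.div_eq_of_lt (by simp only []; omega), Int.toNat_of_nonneg h0]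
    have h3 := Int.dvd_self_sub_emod (x := -(ρ i + p i)) (m := (M : ℤ))
    rw [← dvd_neg] at h3
    refine (congrArg ((M : ℤ) ∣ ·) ?_).mpr h3
    push_cast
    ring
  choose r hr using hr
  set φ := (Fintype.equivFin (Filling d (k + 1).factorial (level c₀ d n₀ k).card)).symm c'
  obtain ⟨a, ha⟩ := φ.exists_label_eq r c
  refine ⟨p + blockPos (level c₀ d n₀ k).side r a, fun i => ?_, fun v hv => ?_⟩
  · have := (dvd_add_cellStart_iff (n := (level c₀ d n₀ k).side) hMN
      (dvd_side_level c₀ n₀ hM hk) (r i) (a i) (ρ i + p i)).2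
      (hr i)
    rwa [add_assoc] at this
  · rw [add_assoc, hp _ (blockPos_add_mem_cube r a hv), ← ha]
    exact fill_blockPos_add c₀ _ φ r a hv

end BlockFamily

/-! ### Uniform frequencies -/

lemma tendsto_ratio_pow (m d : ℕ) :
    Tendsto (fun n : ℕ => (((n : ℝ) - 2 * m) / (n + 2)) ^ d) atTop (𝓝 1) := by
  have h : Tendsto (fun n : ℕ => ((n : ℝ) - 2 * m) / (n + 2)) atTop (𝓝 1) := by
    have h1 : Tendsto (fun n : ℕ => (2 * m + 2 : ℝ) / ((n : ℝ) + 2)) atTop (𝓝 0) :=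
      tendsto_const_nhds.div_atTop
        (tendsto_atTop_add_const_right _ _ tendsto_natCast_atTop_atTop)
    have h2 := h1.const_sub 1
    rw [sub_zero] at h2
    refine h2.congr fun n => ?_
    have : (n : ℝ) + 2 ≠ 0 := by positivity
    field_simp
    ring
  simpa using h.pow d

namespace BlockFamily

variable {C : Type*} {d : ℕ}

lemma count_le (B : BlockFamily C d) {P : Finset (Fin d → ℤ)} {w : (Fin d → ℤ) → C} {M m : ℕ}
    (hm : 2 * m ≤ B.side) (c : Fin B.card) (ρ : Fin d → ℤ) :
    B.count P w M m c ρ ≤ ((B.side : ℝ) - 2 * m) ^ d := by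
  rw [← card_innerBox hm, count]
  simpa using Finset.sum_le_card_nsmul (innerBox d m B.side) _ 1 fun v _ => hit_le_one _ _ _

variable [NeZero d] [Fintype C] {c₀ : C} {n₀ : ℕ}

/-- The frequency of a pattern along `M ℤ^d` is almost the same in all configurations of the
subshift, uniformly over all sufficiently large windows. -/
lemma exists_window_bounds (P : Finset (Fin d → ℤ)) (w : (Fin d → ℤ) → C) {M : ℕ} (hM : 0 < M)
    {ε : ℝ} (hε : 0 < ε) : ∃ l : ℕ, 0 < l ∧ ∃ D : ℝ, ∀ x ∈ limitSet c₀ d n₀,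
      |∑ v ∈ innerBox d 0 (M * l), hit P w M x 0 v - D * ((M * l : ℕ) : ℝ) ^ d| ≤
        ε * ((M * l : ℕ) : ℝ) ^ d := by
  classical
  obtain ⟨m, hP⟩ := exists_abs_le_of_finset P
  obtain ⟨n₁, hn₁⟩ := eventually_atTop.1
    ((tendsto_ratio_pow m d).eventually_const_lt (show 1 - ε / 4 < 1 by linarith))
  set k := M + n₁ + 2 * m with hk
  set B := level c₀ d n₀ k with hB
  have hBn : k ≤ B.side := le_side_level _ _ _
  set n := B.side with hn
  set N := (k + 1).factorial with hN
  have hN0 : 0 < N := Nat.factorial_pos _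
  obtain ⟨H, hH0, hH⟩ := exists_count_next_bounds c₀ B hN0 (card_level_pos _ _ _)
    (Nat.dvd_factorial hM (by omega)) (dvd_side_level c₀ n₀ hM (by omega)) (m := m) (by omega) w hP
  set B' := level c₀ d n₀ (k + 1) with hB'
  change ∀ c ρ, H ≤ B'.count P w M m c ρ ∧ B'.count P w M m c ρ ≤ H + (((B'.side : ℝ) - 2 * m) ^ d -
        (2 * N * B.card * ((B.side : ℝ) - 2 * m)) ^ d) at hH
  have hBn' : k + 1 ≤ B'.side := le_side_level _ _ _
  have hside' : (B'.side : ℝ) = 2 * N * B.card * (n + 1) := by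
    simp only [hB', level, next, hN, hn, hB]; push_cast; rfl
  set n' := B'.side with hn'
  set j : ℝ := ((n' : ℝ) - 2 * m) ^ d with hj
  set e : ℝ := j - (2 * N * B.card * ((n : ℝ) - 2 * m)) ^ d with he
  have hnm : (2 * m : ℝ) ≤ n := by exact_mod_cast (by omega : 2 * m ≤ n)
  have hnm' : (2 * m + 1 : ℝ) ≤ n' := by exact_mod_cast (by omega : 2 * m + 1 ≤ n')
  have hj0 : 0 < j := pow_pos (by linarith) d
  have hHj : H ≤ j :=
    (hH ⟨0, card_level_pos _ _ _⟩ 0).1.trans (count_le B' (by omega) _ _)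
  have hej : e ≤ ε / 4 * j := by
    have h1 : ((n : ℝ) - 2 * m) / (n + 2) * (n' - 2 * m) ≤ 2 * N * B.card * ((n : ℝ) - 2 * m) := by
      rw [div_mul_eq_mul_div, div_le_iff₀ (by positivity), mul_comm (2 * (N : ℝ) * B.card),
          mul_assoc]
      refine mul_le_mul_of_nonneg_left ?_ (by linarith)
      rw [hside']
      have : (0 : ℝ) ≤ 2 * N * B.card := by positivity
      nlinarith [(Nat.cast_nonneg m : (0 : ℝ) ≤ m)]
    have h2 := pow_le_pow_left₀ (mul_nonneg (div_nonneg (by linarith) (by positivity))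
      (by linarith)) h1 d
    rw [mul_pow] at h2
    have h3 := mul_le_mul_of_nonneg_right (hn₁ n (by omega)).le hj0.le
    rw [he]
    linarith
  -- the window has to be large compared with the blocks of level `k + 1`
  have hlim : Tendsto
      (fun l : ℕ => (((n' : ℝ) - 2 * m) * (1 / (n' + 2) - 2 / ((M * l : ℕ) : ℝ))) ^ d)
      atTop (𝓝 ((((n' : ℝ) - 2 * m) * (1 / (n' + 2) - 0)) ^ d)) := by
    refine ((Tendsto.const_mul _ (tendsto_const_nhds.sub ?_))).pow d
    refine tendsto_const_nhds.div_atTop (tendsto_natCast_atTop_atTop.comp ?_)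
    exact tendsto_id.const_mul_atTop' hM
  have hlt : 1 - ε / 4 < (((n' : ℝ) - 2 * m) * (1 / (n' + 2) - 0)) ^ d := by
    rw [sub_zero, mul_one_div]
    exact hn₁ n' (by omega)
  obtain ⟨l, hl1, hl2⟩ := ((hlim.eventually_const_lt hlt).and
    (eventually_ge_atTop (2 * (n' + 2)))).exists
  have hl0 : 0 < l := by omega
  refine ⟨l, hl0, H / j, fun x hx => ?_⟩
  set L := M * l with hL
  have hLn : 2 * (n' + 2) ≤ L := hl2.trans (Nat.le_mul_of_pos_left l hM)
  have hL0 : 0 < L := by omega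
  obtain ⟨K, hK, c', a, ha⟩ := hx (innerBox d 0 L ∪ Finset.image₂ (· + ·) (innerBox d 0 L) P)
      (k + 1)
  have hsum : ∑ v ∈ innerBox d 0 L, hit P w M x 0 v =
      ∑ v ∈ innerBox d 0 L, hit P w M ((level c₀ d n₀ K).config c') (-a) (a + v) := by
    refine Finset.sum_congr rfl fun v hv => ?_
    have h1 : (∀ u ∈ P, x (v + u) = w u) ↔
        ∀ u ∈ P, (level c₀ d n₀ K).config c' (a + v + u) = w u := by
      refine forall₂_congr fun u hu => ?_
      rw [(ha _ (Finset.mem_union_right _ (Finset.mem_image₂_of_mem hv hu))).2, add_assoc]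
    have h2 : (∀ i, (M : ℤ) ∣ v i + (0 : Fin d → ℤ) i) ↔ ∀ i, (M : ℤ) ∣ (a + v) i + (-a) i := by
      refine forall_congr' fun i => ?_
      rw [show (a + v) i + (-a) i = v i + (0 : Fin d → ℤ) i by
        simp only [Pi.add_apply, Pi.neg_apply, Pi.zero_apply]; ring]
    unfold hit
    split_ifs with p q q
    · rfl
    · exact absurd ⟨h2.1 p.1, h1.1 p.2⟩ q
    · exact absurd ⟨h2.2 q.1, h1.2 q.2⟩ p
    · rfl
  have hend (i : Fin d) : 0 ≤ a i ∧ a i + L ≤ (level c₀ d n₀ K).side := by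
    have h1 := (ha (fun _ => 0)
        (Finset.mem_union_left _ (mem_innerBox.2 fun i => by simp; omega))).1 i
    have h2 := (ha (fun _ => L - 1)
      (Finset.mem_union_left _ (mem_innerBox.2 fun i => by simp; omega))).1 i
    simp only [Pi.add_apply] at h1 h2
    omega
  obtain ⟨R, hR1, hR2, hR3, hR4⟩ := (tiles_level c₀ n₀ hK).window_bounds hP
    (show 2 * m ≤ n' by omega) hH c' hend hLn (-a)
  rw [← hsum] at hR3 hR4
  set S := ∑ v ∈ innerBox d 0 L, hit P w M x 0 v with hS
  change ((L : ℝ) / (n' + 2) - 2) ^ d ≤ R at hR1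
  change R * j ≤ (L : ℝ) ^ d at hR2
  change S ≤ R * (H + e) + ((L : ℝ) ^ d - R * j) at hR4
  have hLd : (0 : ℝ) < (L : ℝ) ^ d := by positivity
  have hRj : (1 - ε / 4) * (L : ℝ) ^ d ≤ R * j := by
    have h1 := mul_le_mul_of_nonneg_right hl1.le hLd.le
    have h2 := mul_le_mul_of_nonneg_right hR1 hj0.le
    refine h1.trans (le_trans (le_of_eq ?_) h2)
    rw [hj, ← mul_pow, ← mul_pow]
    congr 1
    have : (L : ℝ) ≠ 0 := by positivity
    field_simp
  have hR0 : 0 ≤ R := by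
    refine le_trans (pow_nonneg ?_ d) hR1
    rw [sub_nonneg, le_div_iff₀ (by positivity)]
    exact_mod_cast hLn
  have hD0 : 0 ≤ H / j := div_nonneg hH0 hj0.le
  have hD1 : H / j ≤ 1 := (div_le_one hj0).2 hHj
  have hRH : R * H = H / j * (R * j) := by field_simp
  have hRe : R * e ≤ ε / 4 * (L : ℝ) ^ d := by
    calc R * e ≤ R * (ε / 4 * j) := mul_le_mul_of_nonneg_left hej hR0
      _ = ε / 4 * (R * j) := by ring
      _ ≤ _ := mul_le_mul_of_nonneg_left hR2 (by positivity)
  rw [abs_le]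
  constructor
  · have h1 : H / j * ((1 - ε / 4) * (L : ℝ) ^ d) ≤ H / j * (R * j) :=
      mul_le_mul_of_nonneg_left hRj hD0
    have h2 : H / j * (ε / 4 * (L : ℝ) ^ d) ≤ 1 * (ε / 4 * (L : ℝ) ^ d) :=
      mul_le_mul_of_nonneg_right hD1 (by positivity)
    nlinarith
  · have h1 : H / j * (R * j) ≤ H / j * (L : ℝ) ^ d := mul_le_mul_of_nonneg_left hR2 hD0
    nlinarith

end BlockFamily

/-! ### Existence of invariant measures -/

section invariant

variable {d : ℕ}

lemma abs_sum_sub_sum_le {V : Type*} [DecidableEq V] {Q J : Finset V} (h : J ⊆ Q) {F : V → ℝ}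
    {b : ℝ} (hF : ∀ v, |F v| ≤ b) :
    |∑ v ∈ Q, F v - ∑ v ∈ J, F v| ≤ b * ((Q.card : ℝ) - J.card) := by
  rw [← Finset.sum_sdiff h, add_sub_cancel_right, ← Finset.cast_card_sdiff h, mul_comm]
  refine (Finset.abs_sum_le_sum_abs _ _).trans ?_
  simpa using Finset.sum_le_card_nsmul (Q \ J) _ b fun v _ => hF v

/-- Averages of a bounded function over large cubes hardly change under translations. -/
lemma tendsto_average_sub_average {F : (Fin d → ℤ) → ℝ} {b : ℝ} (hF : ∀ v, |F v| ≤ b)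
    (h : Fin d → ℤ) :
    Tendsto (fun n : ℕ => ((innerBox d 0 n).card : ℝ)⁻¹ * ∑ v ∈ innerBox d 0 n, F (v + h) -
      ((innerBox d 0 n).card : ℝ)⁻¹ * ∑ v ∈ innerBox d 0 n, F v) atTop (𝓝 0) := by
  classical
  obtain ⟨m, hm⟩ := exists_abs_le_of_finset {h}
  have hm' := hm h (Finset.mem_singleton_self h)
  have hlim : Tendsto (fun n : ℕ => 2 * b * (1 - (((n : ℝ) - 2 * m) / (n + 2)) ^ d)) atTop
      (𝓝 0) := by
    have := ((tendsto_ratio_pow m d).const_sub 1).const_mul (2 * b)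
    simpa using this
  refine squeeze_zero_norm' ?_ hlim
  filter_upwards [eventually_ge_atTop (2 * m + 1)] with n hn
  have hn0 : (0 : ℝ) < n := by exact_mod_cast (by omega : 0 < n)
  have hcard : ((innerBox d 0 n).card : ℝ) = (n : ℝ) ^ d := by
    rw [card_innerBox (by omega)]; simp
  have hcardJ := card_innerBox (d := d) (m := m) (n := n) (by omega)
  have hsub : innerBox d m n ⊆ innerBox d 0 n := fun v hv => by
    rw [mem_innerBox] at hv ⊢
    intro i
    have := hv i
    omega
  have hsub' : innerBox d m n ⊆ (innerBox d 0 n).image (· + h) := fun v hv => by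
    rw [mem_innerBox] at hv
    refine Finset.mem_image.2 ⟨v - h, mem_innerBox.2 fun i => ?_, sub_add_cancel v h⟩
    have h1 := hv i
    have h2 := abs_le.1 (hm' i)
    simp only [Pi.sub_apply]
    omega
  have hinj : Function.Injective fun v : Fin d → ℤ => v + h := add_left_injective h
  have h1 := abs_sum_sub_sum_le hsub hF
  have h2 := abs_sum_sub_sum_le hsub' hF
  rw [Finset.sum_image hinj.injOn, Finset.card_image_of_injective _ hinj] at h2
  rw [hcardJ, hcard] at h1 h2
  rw [hcard, ← mul_sub, Real.norm_eq_abs, abs_mul,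
    abs_of_nonneg (by positivity : 0 ≤ ((n : ℝ) ^ d)⁻¹)]
  have h3 : |∑ v ∈ innerBox d 0 n, F (v + h) - ∑ v ∈ innerBox d 0 n, F v| ≤
      2 * b * ((n : ℝ) ^ d - ((n : ℝ) - 2 * m) ^ d) := by
    have := abs_sub_le (∑ v ∈ innerBox d 0 n, F (v + h)) (∑ v ∈ innerBox d m n, F v)
      (∑ v ∈ innerBox d 0 n, F v)
    rw [abs_sub_comm (∑ v ∈ innerBox d m n, F v)] at this
    linarith
  have hb : 0 ≤ b := (abs_nonneg _).trans (hF 0)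
  have hnm : (0 : ℝ) ≤ n - 2 * m := by
    rw [sub_nonneg]; exact_mod_cast (by omega : 2 * m ≤ n)
  calc ((n : ℝ) ^ d)⁻¹ * |∑ v ∈ innerBox d 0 n, F (v + h) - ∑ v ∈ innerBox d 0 n, F v|
      ≤ ((n : ℝ) ^ d)⁻¹ * (2 * b * ((n : ℝ) ^ d - ((n : ℝ) - 2 * m) ^ d)) := by gcongr
    _ = 2 * b * (1 - (((n : ℝ) - 2 * m) / n) ^ d) := by rw [div_pow]; field_simp
    _ ≤ 2 * b * (1 - (((n : ℝ) - 2 * m) / (n + 2)) ^ d) := by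
      gcongr
      linarith

/-- The Krylov–Bogoliubov theorem for actions of `ℤ^d` on compact metrizable spaces. -/
theorem exists_invariant_probabilityMeasure {X : Type*} [TopologicalSpace X] [CompactSpace X]
    [TopologicalSpace.MetrizableSpace X] [MeasurableSpace X] [BorelSpace X] [Nonempty X]
    [AddAction (Fin d → ℤ) X] (hcont : ∀ g : Fin d → ℤ, Continuous fun x : X => g +ᵥ x) :
    ∃ μ : Measure X, IsProbabilityMeasure μ ∧ VAddInvariantMeasure (Fin d → ℤ) X μ := by
  obtain ⟨x₀⟩ := ‹Nonempty X›
  let ν (n : ℕ) : Measure X := ((innerBox d 0 (n + 1)).card : ENNReal)⁻¹ •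
    ∑ g ∈ innerBox d 0 (n + 1), Measure.dirac (g +ᵥ x₀)
  have hne (n : ℕ) : (innerBox d 0 (n + 1)).card ≠ 0 := by
    have : (fun _ => 0) ∈ innerBox d 0 (n + 1) := mem_innerBox.2 fun i => by simp
    exact Finset.card_ne_zero_of_mem this
  have hprob (n : ℕ) : IsProbabilityMeasure (ν n) := by
    constructor
    simp only [ν, Measure.smul_apply, Measure.coe_finsetSum, Finset.sum_apply, measure_univ,
      Finset.sum_const, nsmul_eq_mul, mul_one, smul_eq_mul]
    exact ENNReal.inv_mul_cancel (by exact_mod_cast hne n) (ENNReal.natCast_ne_top _)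
  have hint (n : ℕ) (f : BoundedContinuousFunction X ℝ) : ∫ x, f x ∂(ν n) =
      ((innerBox d 0 (n + 1)).card : ℝ)⁻¹ * ∑ g ∈ innerBox d 0 (n + 1), f (g +ᵥ x₀) := by
    rw [integral_smul_measure, integral_finsetSum_measure fun g _ => f.integrable _]
    simp [integral_dirac]
  let P (n : ℕ) : ProbabilityMeasure X := ⟨ν n, hprob n⟩
  let U : Ultrafilter (ProbabilityMeasure X) := (Filter.hyperfilter ℕ).map P
  have hU : Tendsto P (Filter.hyperfilter ℕ : Filter ℕ) (𝓝 U.lim) := U.le_nhds_lim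
  set μ := U.lim
  rw [ProbabilityMeasure.tendsto_iff_forall_integral_tendsto] at hU
  refine ⟨μ, inferInstance, ⟨fun h s hs => ?_⟩⟩
  have hmeas : Measurable fun x : X => h +ᵥ x := (hcont h).measurable
  have hmap : (μ : Measure X).map (fun x => h +ᵥ x) = μ := by
    have : IsProbabilityMeasure ((μ : Measure X).map (fun x => h +ᵥ x)) :=
      Measure.isProbabilityMeasure_map hmeas.aemeasurable
    refine ext_of_forall_integral_eq_of_IsFiniteMeasure fun f => ?_
    rw [integral_map hmeas.aemeasurable f.continuous.aestronglyMeasurable]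
    let f' : BoundedContinuousFunction X ℝ := f.compContinuous ⟨fun x => h +ᵥ x, hcont h⟩
    have h1 := (hU f').sub (hU f)
    have h2 : Tendsto (fun n => ∫ x, f' x ∂(P n : Measure X) - ∫ x, f x ∂(P n : Measure X))
        (Filter.hyperfilter ℕ : Filter ℕ) (𝓝 0) := by
      have h3 := (tendsto_average_sub_average (F := fun g => f (g +ᵥ x₀)) (b := ‖f‖)
        (fun v => f.norm_coe_le_norm _) h).comp (tendsto_add_atTop_nat 1)
      refine (h3.mono_left Nat.hyperfilter_le_atTop).congr fun n => ?_
      change _ = ∫ x, f' x ∂(ν n) - ∫ x, f x ∂(ν n)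
      rw [hint, hint]
      simp only [Function.comp_apply, f', BoundedContinuousFunction.compContinuous_apply,
        ContinuousMap.coe_mk, ← add_vadd, add_comm h]
    exact sub_eq_zero.1 (tendsto_nhds_unique h1 h2)
  conv_rhs => rw [← hmap]
  rw [Measure.map_apply hmeas hs]

end invariant

/-! ### Total strict ergodicity -/

namespace BlockFamily

section patternSet

variable {C : Type*} {d : ℕ}

lemma hit_eq_zero {P : Finset (Fin d → ℤ)} {w : (Fin d → ℤ) → C} {M : ℕ} {v : Fin d → ℤ}
    (hv : ¬ ∀ i, (M : ℤ) ∣ v i) (x : (Fin d → ℤ) → C) : hit P w M x 0 v = 0 :=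
  if_neg fun h => hv fun i => by simpa using h.1 i

open Classical in
lemma pow_le_card_filter_dvd {M : ℕ} (hM : 0 < M) (l : ℕ) :
    (l : ℝ) ^ d ≤ ((innerBox d 0 (M * l)).filter fun v => ∀ i, (M : ℤ) ∣ v i).card := by
  have h : (innerBox d 0 l).card ≤
      ((innerBox d 0 (M * l)).filter fun v => ∀ i, (M : ℤ) ∣ v i).card := by
    refine Finset.card_le_card_of_injOn (fun v => M • v) (fun v hv => ?_) fun v _ v' _ h => ?_
    · rw [Finset.mem_coe, mem_innerBox] at hv
      refine Finset.mem_coe.2 (Finset.mem_filter.2 ⟨mem_innerBox.2 fun i => ?_, fun i => by simp⟩)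
      have h1 := hv i
      simp only [Nat.cast_zero, sub_zero] at h1 ⊢
      simp only [Pi.smul_apply, nsmul_eq_mul]
      push_cast
      exact ⟨mul_nonneg (by omega) h1.1, mul_lt_mul_of_pos_left h1.2 (by exact_mod_cast hM)⟩
    · funext i
      have := congrFun h i
      simp only [Pi.smul_apply, nsmul_eq_mul] at this
      exact mul_left_cancel₀ (by exact_mod_cast hM.ne') this
  have h2 := card_innerBox (d := d) (m := 0) (n := l) (by omega)
  simp only [Nat.cast_zero, mul_zero, sub_zero] at h2
  rw [← h2]
  exact_mod_cast h

variable [TopologicalSpace C]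

/-- The points of a subshift at which a pattern occurs at the origin. -/
def patternSet (X : Subshift C (Fin d → ℤ)) (P : Finset (Fin d → ℤ)) (w : (Fin d → ℤ) → C) :
    Set X.carrier := {x | ∀ u ∈ P, x.1 u = w u}

lemma continuous_vadd_subshift (X : Subshift C (Fin d → ℤ)) (g : Fin d → ℤ) :
    Continuous fun x : X.carrier => g +ᵥ x :=
  ((continuous_shift g).comp continuous_subtype_val).subtype_mk _

lemma measurableSet_patternSet [Fintype C] [DiscreteTopology C] [MeasurableSpace C] [BorelSpace C]
    (X : Subshift C (Fin d → ℤ)) (P : Finset (Fin d → ℤ))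
    (w : (Fin d → ℤ) → C) : MeasurableSet (patternSet X P w) :=
  ((isOpen_cylinder P w).preimage continuous_subtype_val).measurableSet

lemma hit_eq_indicator (X : Subshift C (Fin d → ℤ)) (P : Finset (Fin d → ℤ))
    (w : (Fin d → ℤ) → C) (M : ℕ) {v : Fin d → ℤ} (hv : ∀ i, (M : ℤ) ∣ v i) (x : X.carrier) :
    hit P w M x.1 0 v = ((fun x => v +ᵥ x) ⁻¹' patternSet X P w).indicator 1 x := by
  classical
  rw [Set.indicator_apply]
  have h : (x ∈ (fun x => v +ᵥ x) ⁻¹' patternSet X P w) ↔ ∀ u ∈ P, x.1 (v + u) = w u := Iff.rfl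
  unfold hit
  split_ifs with p q q
  · rfl
  · exact absurd (h.2 p.2) q
  · exact absurd ⟨fun i => by simpa using hv i, h.1 q⟩ p
  · rfl

variable [Fintype C] [DiscreteTopology C] [MeasurableSpace C] [BorelSpace C]
  {X : Subshift C (Fin d → ℤ)} {F : AddSubgroup (Fin d → ℤ)} {M : ℕ}

lemma integrable_hit (μ : Measure X.carrier) [IsProbabilityMeasure μ] (P : Finset (Fin d → ℤ))
    (w : (Fin d → ℤ) → C) (v : Fin d → ℤ) :
    Integrable (fun x : X.carrier => hit P w M x.1 0 v) μ := by
  by_cases hv : ∀ i, (M : ℤ) ∣ v i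
  · simp only [hit_eq_indicator X P w M hv]
    exact (integrable_const (1 : ℝ)).indicator
      ((continuous_vadd_subshift X v).measurable (measurableSet_patternSet X P w))
  · simp only [hit_eq_zero hv]
    exact integrable_zero _ _ _

open Classical in
lemma integral_hit (μ : Measure X.carrier)
    [IsProbabilityMeasure μ] [VAddInvariantMeasure F X.carrier μ]
    (hF : ∀ a, M • a ∈ F) (P : Finset (Fin d → ℤ)) (w : (Fin d → ℤ) → C) (v : Fin d → ℤ) :
    ∫ x : X.carrier, hit P w M x.1 0 v ∂μ =
      if ∀ i, (M : ℤ) ∣ v i then μ.real (patternSet X P w) else 0 := by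
  split_ifs with hv
  · have hmeas := measurableSet_patternSet X P w
    simp only [hit_eq_indicator X P w M hv]
    rw [integral_indicator_one ((continuous_vadd_subshift X v).measurable hmeas)]
    choose a ha using hv
    have hmem : v ∈ F := by
      have : v = M • a := funext fun i => by simpa using ha i
      rw [this]
      exact hF a
    exact congrArg ENNReal.toReal
      (VAddInvariantMeasure.measure_preimage_vadd (⟨v, hmem⟩ : F) hmeas)
  · simp only [hit_eq_zero hv]
    simp

end patternSet

variable {C : Type*} {d : ℕ} [NeZero d] [Fintype C] [TopologicalSpace C] [DiscreteTopology C]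
  {c₀ : C} {n₀ : ℕ}

lemma isMinimal_limitShift (F : AddSubgroup (Fin d → ℤ)) [F.FiniteIndex] :
    AddAction.IsMinimal F (limitShift c₀ d n₀).carrier := by
  refine ⟨fun x => ?_⟩
  intro y
  rw [mem_closure_iff]
  rintro U ⟨V, hV, rfl⟩ hy
  obtain ⟨S, u, hu, hSV⟩ := isOpen_pi_iff.1 hV y.1 hy
  have hM : 0 < F.index := Nat.pos_of_ne_zero AddSubgroup.FiniteIndex.index_ne_zero
  obtain ⟨K, hK, c, p, hp⟩ := y.2 S F.index
  obtain ⟨q, hq, hxq⟩ := exists_block_eq_of_mem_limitSet x.2 hM hK c p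
  choose a ha using hq
  have hmem : p + q ∈ F := by
    have : p + q = F.index • a := funext fun i => by simpa using ha i
    rw [this]
    exact F.nsmul_index_mem a
  refine ⟨(⟨p + q, hmem⟩ : F) +ᵥ x, hSV fun g hg => ?_, AddAction.mem_orbit _ _⟩
  have h1 : ((⟨p + q, hmem⟩ : F) +ᵥ x).1 g = y.1 g := by
    rw [(hp g hg).2, ← hxq _ (hp g hg).1]
    change x.1 (p + q + g) = x.1 (q + (p + g))
    rw [add_comm p q, add_assoc]
  rw [h1]
  exact (hu g hg).2

variable [MeasurableSpace C] [BorelSpace C] {F : AddSubgroup (Fin d → ℤ)}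

/-- Invariant measures give the same mass to every pattern, since both masses are approximated by
the uniform frequencies of the pattern. -/
lemma measure_patternSet_eq [F.FiniteIndex] {μ ν : Measure (limitShift c₀ d n₀).carrier}
    [IsProbabilityMeasure μ] [IsProbabilityMeasure ν]
    [VAddInvariantMeasure F (limitShift c₀ d n₀).carrier μ]
    [VAddInvariantMeasure F (limitShift c₀ d n₀).carrier ν]
    (P : Finset (Fin d → ℤ)) (w : (Fin d → ℤ) → C) :
    μ.real (patternSet _ P w) = ν.real (patternSet _ P w) := by
  classical
  set M := F.index with hMdef
  have hM : 0 < M := Nat.pos_of_ne_zero AddSubgroup.FiniteIndex.index_ne_zero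
  have hF : ∀ a, M • a ∈ F := F.nsmul_index_mem
  have hMd : (0 : ℝ) < (M : ℝ) ^ d := by positivity
  refine eq_of_abs_sub_le_all fun ε hε => ?_
  obtain ⟨l, hl, D, hD⟩ := exists_window_bounds (c₀ := c₀) (n₀ := n₀) P w hM
    (show 0 < ε / (2 * (M : ℝ) ^ d) by positivity)
  set κ : ℝ := (((innerBox d 0 (M * l)).filter fun v => ∀ i, (M : ℤ) ∣ v i).card : ℝ) with hκ
  have hκl : (l : ℝ) ^ d ≤ κ := pow_le_card_filter_dvd hM l
  have hld : (0 : ℝ) < (l : ℝ) ^ d := by positivity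
  set η : ℝ := ε / (2 * (M : ℝ) ^ d) * ((M * l : ℕ) : ℝ) ^ d with hη
  have hηl : 2 * η = ε * (l : ℝ) ^ d := by
    rw [hη]; push_cast; rw [mul_pow]; field_simp
  have key (ρ : Measure (limitShift c₀ d n₀).carrier) [IsProbabilityMeasure ρ]
      [VAddInvariantMeasure F (limitShift c₀ d n₀).carrier ρ] :
      |κ * ρ.real (patternSet _ P w) - D * ((M * l : ℕ) : ℝ) ^ d| ≤ η := by
    have hi := integrable_finsetSum (innerBox d 0 (M * l))
      fun v _ => integrable_hit (M := M) ρ P w v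
    have h1 : ∫ x : (limitShift c₀ d n₀).carrier, (∑ v ∈ innerBox d 0 (M * l), hit P w M x.1 0 v -
        D * ((M * l : ℕ) : ℝ) ^ d) ∂ρ =
        κ * ρ.real (patternSet _ P w) - D * ((M * l : ℕ) : ℝ) ^ d := by
      rw [integral_sub hi (integrable_const _),
          integral_finsetSum _ fun v _ => integrable_hit ρ P w v]
      simp only [integral_hit ρ hF]
      rw [← Finset.sum_filter, Finset.sum_const, nsmul_eq_mul]
      simp [hκ]
    rw [← h1, ← Real.norm_eq_abs]
    refine (norm_integral_le_of_norm_le_const (C := η) (ae_of_all _ fun x => hD x.1 x.2)).trans ?_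
    simp
  have h1 := abs_sub_le (κ * μ.real (patternSet _ P w)) (D * ((M * l : ℕ) : ℝ) ^ d)
    (κ * ν.real (patternSet _ P w))
  rw [abs_sub_comm (D * ((M * l : ℕ) : ℝ) ^ d)] at h1
  have h2 := h1.trans (add_le_add (key μ) (key ν))
  rw [← mul_sub, abs_mul, abs_of_nonneg (hld.le.trans hκl)] at h2
  have h3 := mul_le_mul_of_nonneg_right hκl
    (abs_nonneg (μ.real (patternSet _ P w) - ν.real (patternSet _ P w)))
  have h4 : (l : ℝ) ^ d * |μ.real (patternSet _ P w) - ν.real (patternSet _ P w)| ≤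
      (l : ℝ) ^ d * ε := by linarith
  exact le_of_mul_le_mul_left h4 hld

lemma invariantMeasure_unique [F.FiniteIndex] {μ ν : Measure (limitShift c₀ d n₀).carrier}
    [IsProbabilityMeasure μ] [IsProbabilityMeasure ν]
    [VAddInvariantMeasure F (limitShift c₀ d n₀).carrier μ]
    [VAddInvariantMeasure F (limitShift c₀ d n₀).carrier ν] : μ = ν := by
  classical
  have hval : MeasurableEmbedding (Subtype.val : (limitShift c₀ d n₀).carrier → _) :=
    MeasurableEmbedding.subtype_coe (limitShift c₀ d n₀).isClosed.measurableSet
  have hmap : μ.map Subtype.val = ν.map Subtype.val := by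
    have hr (I : Finset (Fin d → ℤ)) : Measurable (I.restrict (π := fun _ => C)) :=
      Finset.measurable_restrict I
    have hfin (I : Finset (Fin d → ℤ)) : IsFiniteMeasure ((ν.map Subtype.val).map
      (I.restrict (π := fun _ => C))) := inferInstance
    refine IsProjectiveLimit.unique (α := fun _ : Fin d → ℤ => C)
      (P := fun I => (ν.map Subtype.val).map I.restrict) (fun I => ?_) fun I => rfl
    rw [Measure.ext_iff_singleton]
    intro s
    have hpre : Subtype.val ⁻¹' (I.restrict (π := fun _ => C) ⁻¹' {s}) =
        patternSet (limitShift c₀ d n₀) I (fun g => if h : g ∈ I then s ⟨g, h⟩ else c₀) := by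
      ext x
      simp only [Set.mem_preimage, Set.mem_singleton_iff, patternSet, Set.mem_ofPred_eq, funext_iff,
        Subtype.forall, Finset.restrict]
      exact forall₂_congr fun g hg => by rw [dif_pos hg]
    have h1 := measure_patternSet_eq (F := F) (μ := μ) (ν := ν) I
      (fun g => if h : g ∈ I then s ⟨g, h⟩ else c₀)
    rw [Measure.map_apply (hr I) (measurableSet_singleton s),
      Measure.map_apply (hr I) (measurableSet_singleton s), hval.map_apply, hval.map_apply, hpre]
    exact (ENNReal.toReal_eq_toReal_iff' (measure_ne_top _ _) (measure_ne_top _ _)).1 h1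
  rw [← hval.comap_map μ, hmap, hval.comap_map]

theorem isTotallyStrictlyErgodic_limitShift :
    IsTotallyStrictlyErgodic (Fin d → ℤ) (limitShift c₀ d n₀).carrier := by
  intro F hF
  have hne : Nonempty (limitShift c₀ d n₀).carrier := (limitSet_nonempty c₀ n₀).to_subtype
  have hcpt : CompactSpace (limitShift c₀ d n₀).carrier :=
    isCompact_iff_compactSpace.1 (limitShift c₀ d n₀).isClosed.isCompact
  refine ⟨isMinimal_limitShift F, ?_⟩
  obtain ⟨μ, hμ, hinv⟩ := exists_invariant_probabilityMeasure (d := d)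
    (continuous_vadd_subshift (limitShift c₀ d n₀))
  have hinv' : VAddInvariantMeasure F (limitShift c₀ d n₀).carrier μ :=
    ⟨fun g s hs => hinv.measure_preimage_vadd (g : Fin d → ℤ) hs⟩
  refine ⟨μ, ⟨hμ, hinv'⟩, fun ν hν => ?_⟩
  have := hν.1
  have := hν.2
  exact invariantMeasure_unique (F := F)

end BlockFamily

/-! ### Existence of the entropy -/

section entropy

variable {C : Type*} {d : ℕ}

lemma finite_cube (d n : ℕ) : Finite (cube d n) :=
  ((innerBox d 0 n).finite_toSet.subset fun v hv => mem_innerBox.2 fun i => by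
    simpa using hv i).to_subtype

variable [Fintype C] [TopologicalSpace C]

/-- A pattern on `[0, n)^d` is determined by its restrictions to `(n / m + 1)^d` translates of
`[0, m)^d`. -/
lemma ncard_patternsOn_le (X : Subshift C (Fin d → ℤ)) {m : ℕ} (hm : 0 < m) (n : ℕ) :
    (patternsOn X.carrier (cube d n)).ncard ≤
      (patternsOn X.carrier (cube d m)).ncard ^ (n / m + 1) ^ d := by
  have := finite_cube d m
  choose x hx hxz using fun z : patternsOn X.carrier (cube d n) => z.2
  let f (z : patternsOn X.carrier (cube d n)) (b : Fin d → Fin (n / m + 1)) :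
      patternsOn X.carrier (cube d m) :=
    ⟨_, Set.mem_image_of_mem _ (X.mapsTo (fun i => ((m * (b i : ℕ) : ℕ) : ℤ)) (hx z))⟩
  have hf : Function.Injective f := by
    intro z z' hzz
    apply Subtype.ext
    rw [← hxz z, ← hxz z']
    funext g
    have h1 (i : Fin d) : (g.1 i).toNat < n := by have := g.2 i; omega
    let b (i : Fin d) : Fin (n / m + 1) :=
      ⟨(g.1 i).toNat / m, Nat.lt_succ_of_le (Nat.div_le_div_right (h1 i).le)⟩
    let v : cube d m := ⟨fun i => (((g.1 i).toNat % m : ℕ) : ℤ), fun i =>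
      ⟨Int.natCast_nonneg _, Int.ofNat_lt.2 (Nat.mod_lt _ hm)⟩⟩
    have h2 := congrFun (congrArg Subtype.val (congrFun hzz b)) v
    have h3 : (fun i => ((m * (b i : ℕ) : ℕ) : ℤ)) + v.1 = g.1 := by
      funext i
      have h4 := Nat.div_add_mod (g.1 i).toNat m
      have h5 := g.2 i
      change ((m * ((g.1 i).toNat / m) : ℕ) : ℤ) + (((g.1 i).toNat % m : ℕ) : ℤ) = g.1 i
      omega
    change x z ((fun i => ((m * (b i : ℕ) : ℕ) : ℤ)) + v.1) =
      x z' ((fun i => ((m * (b i : ℕ) : ℕ) : ℤ)) + v.1) at h2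
    rw [h3] at h2
    exact h2
  have h := Nat.card_le_card_of_injective f hf
  rw [Nat.card_fun, Nat.card_fun, Nat.card_fin, Nat.card_fin] at h
  exact h

lemma ncard_patternsOn_pos {X : Subshift C (Fin d → ℤ)} (hX : X.carrier.Nonempty) (n : ℕ) :
    0 < (patternsOn X.carrier (cube d n)).ncard := by
  have := finite_cube d n
  exact (Set.ncard_pos (Set.toFinite _)).2 (hX.image _)

/-- The topological entropy of a nonempty subshift exists. -/
theorem exists_hasTopologicalEntropy {X : Subshift C (Fin d → ℤ)} (hX : X.carrier.Nonempty) :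
    ∃ h : ℝ, HasTopologicalEntropy X h := by
  let a (n : ℕ) : ℝ := Real.log ((patternsOn X.carrier (cube d n)).ncard : ℝ)
  have ha0 (n : ℕ) : 0 ≤ a n := Real.log_nonneg (by exact_mod_cast ncard_patternsOn_pos hX n)
  have hsub {m : ℕ} (hm : 0 < m) (n : ℕ) : a n ≤ ((n / m + 1 : ℕ) : ℝ) ^ d * a m := by
    have h1 : ((patternsOn X.carrier (cube d n)).ncard : ℝ) ≤
        ((patternsOn X.carrier (cube d m)).ncard : ℝ) ^ (n / m + 1) ^ d := by
      exact_mod_cast ncard_patternsOn_le X hm n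
    have h2 := Real.log_le_log (by exact_mod_cast ncard_patternsOn_pos hX n) h1
    rw [Real.log_pow] at h2
    exact_mod_cast h2
  let A : Set ℝ := (fun m : ℕ => a m / (m : ℝ) ^ d) '' Set.Ici 1
  have hbdd : BddBelow A := by
    refine ⟨0, ?_⟩
    rintro _ ⟨m, -, rfl⟩
    exact div_nonneg (ha0 m) (by positivity)
  have hne : A.Nonempty := ⟨_, 1, Set.self_mem_Ici, rfl⟩
  refine ⟨sInf A, tendsto_order.2 ⟨fun b hb => ?_, fun b hb => ?_⟩⟩
  · filter_upwards [eventually_ge_atTop 1] with n hn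
    exact hb.trans_le (csInf_le hbdd ⟨n, hn, rfl⟩)
  · obtain ⟨_, ⟨m, hm, rfl⟩, hmb⟩ := exists_lt_of_csInf_lt hne hb
    have hm0 : 0 < m := hm
    have hlim : Tendsto (fun n : ℕ => (1 + (m : ℝ) / n) ^ d * (a m / (m : ℝ) ^ d)) atTop
        (𝓝 ((1 + 0) ^ d * (a m / (m : ℝ) ^ d))) :=
      (((tendsto_const_nhds.div_atTop tendsto_natCast_atTop_atTop).const_add 1).pow d).mul_const _
    rw [add_zero, one_pow, one_mul] at hlim
    filter_upwards [hlim.eventually_lt_const hmb, eventually_ge_atTop 1] with n hn hn1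
    refine lt_of_le_of_lt ?_ hn
    have hn0 : (0 : ℝ) < n := by exact_mod_cast hn1
    have hm0' : (0 : ℝ) < m := by exact_mod_cast hm0
    have h1 : ((n / m + 1 : ℕ) : ℝ) ≤ (n : ℝ) / m + 1 := by
      push_cast; gcongr; exact Nat.cast_div_le
    have h2 : a n ≤ ((n : ℝ) / m + 1) ^ d * a m :=
      (hsub hm0 n).trans (mul_le_mul_of_nonneg_right (pow_le_pow_left₀ (by positivity) h1 d)
          (ha0 m))
    rw [div_le_iff₀ (by positivity)]
    refine h2.trans (le_of_eq ?_)
    have h3 : (n : ℝ) / m + 1 = (1 + m / n) * n / m := by field_simp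
    rw [h3, div_pow, mul_pow]
    ring

end entropy

/-! ### Lower bound for the entropy -/

namespace BlockFamily

variable {C : Type*} {d : ℕ} [NeZero d]

/-- One step of the construction reduces the entropy per site only by the padding of the blocks and
by Stirling's formula for the number of permutations. -/
lemma log_card_next_ge (c₀ : C) (N : ℕ) (B : BlockFamily C d) (hB : 0 < B.card) :
    (2 * N * B.card : ℝ) ^ d * (Real.log B.card - 1) ≤ Real.log (B.next c₀ N).card := by
  have hcard : (B.next c₀ N).card = B.card.factorial ^ ((2 * N) ^ d * B.card ^ (d - 1)) := by
    simp [next, Fintype.card_perm]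
  rw [hcard]
  push_cast
  rw [Real.log_pow]
  have h1 := Stirling.le_log_factorial_stirling hB.ne'
  have h2 : 0 ≤ Real.log B.card := Real.log_nonneg (by exact_mod_cast hB)
  have h3 : 0 ≤ Real.log (2 * Real.pi) := Real.log_nonneg (by nlinarith [Real.pi_gt_three])
  have h4 : (B.card : ℝ) * (Real.log B.card - 1) ≤ Real.log B.card.factorial := by linarith
  have h5 : (2 * N * B.card : ℝ) ^ d = ((2 * N) ^ d * B.card ^ (d - 1)) * B.card := by
    rw [mul_pow, mul_assoc, pow_sub_one_mul (NeZero.ne d)]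
  rw [h5, mul_assoc]
  push_cast
  exact mul_le_mul_of_nonneg_left h4 (by positivity)

variable [Fintype C]

/-- If the blocks of level `0` are large, then the entropy per site of the blocks of all levels is
at least `(1 - ν) * log |C|`. -/
lemma log_card_level_ge (c₀ : C) {n₀ : ℕ} (hn₀ : 0 < n₀) {ν : ℝ} (hν : ν ≤ 1)
    (hlarge : 2 * (1 + d * Real.log (Fintype.card C)) ≤ ν * Real.log (Fintype.card C) * n₀)
    (k : ℕ) :
    (1 - ν) * Real.log (Fintype.card C) * ((level c₀ d n₀ k).side : ℝ) ^ d ≤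
      Real.log (level c₀ d n₀ k).card := by
  have : Nonempty C := ⟨c₀⟩
  set lam := Real.log (Fintype.card C) with hlam
  have hlam0 : 0 ≤ lam := Real.log_nonneg (by exact_mod_cast Fintype.card_pos (α := C))
  set κ : ℝ := 1 + d * lam with hκ
  have hκ0 : 0 < κ := by positivity
  have hn₀' : (0 : ℝ) < n₀ := by exact_mod_cast hn₀
  have hκν : 2 * κ / n₀ ≤ ν * lam := by rw [div_le_iff₀ hn₀']; exact hlarge
  have hνlam : ν * lam ≤ lam := by nlinarith
  -- the loss at level `k` is at most `κ / (2 ^ k * n₀)`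
  have key : ∀ k, (lam - 2 * κ / n₀ * (1 - (1 / 2) ^ k)) * ((level c₀ d n₀ k).side : ℝ) ^ d ≤
      Real.log (level c₀ d n₀ k).card := by
    intro k
    induction k with
    | zero =>
      simp only [pow_zero, sub_self, mul_zero, sub_zero, level, full, Fintype.card_fun,
        Fintype.card_fin]
      push_cast
      rw [Real.log_pow, mul_comm]
      push_cast
      rfl
    | succ k ih =>
      set B := level c₀ d n₀ k with hB
      have hlog := log_card_next_ge c₀ (k + 1).factorial B (card_level_pos _ _ _)
      have hside : ((level c₀ d n₀ (k + 1)).side : ℝ) ^ d =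
          (2 * (k + 1).factorial * B.card : ℝ) ^ d * ((B.side : ℝ) + 1) ^ d := by
        simp only [level, next, ← hB]
        push_cast
        rw [mul_pow]
      change _ ≤ Real.log (B.next c₀ (k + 1).factorial).card
      rw [hside]
      set s : ℝ := (2 * (k + 1).factorial * B.card : ℝ) ^ d with hs
      have hs0 : 0 ≤ s := by positivity
      set n : ℝ := (B.side : ℝ) with hn
      have hn0 : 0 ≤ n := Nat.cast_nonneg _
      set ℓ : ℝ := lam - 2 * κ / n₀ * (1 - (1 / 2) ^ k) with hℓ
      have hk0 : (0 : ℝ) < (1 / 2) ^ k := by positivity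
      have hk1 : ((1 / 2 : ℝ)) ^ k ≤ 1 := pow_le_one₀ (by norm_num) (by norm_num)
      have hq0 : 0 ≤ 2 * κ / n₀ := by positivity
      have hℓ0 : 0 ≤ ℓ := by
        have : 2 * κ / n₀ * (1 - (1 / 2) ^ k) ≤ 2 * κ / n₀ * 1 :=
          mul_le_mul_of_nonneg_left (by linarith) hq0
        linarith
      have hℓlam : ℓ ≤ lam := by
        have := mul_nonneg hq0 (sub_nonneg.2 hk1)
        linarith
      have hloss : κ / (n + 1) ≤ 2 * κ / n₀ * (1 / 2) ^ (k + 1) := by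
        have h1 : (2 : ℝ) ^ k * n₀ ≤ n := by
          have h0 : ((2 ^ k * n₀ : ℕ) : ℝ) ≤ B.side :=
            Nat.cast_le.2 (two_pow_mul_le_side_level (d := d) c₀ n₀ k)
          push_cast at h0
          exact h0
        have h2 : 2 * κ / n₀ * (1 / 2) ^ (k + 1) = κ / (2 ^ k * n₀) := by
          rw [pow_succ, one_div, inv_pow]; field_simp
        rw [h2]
        exact div_le_div_of_nonneg_left hκ0.le (by positivity) (by linarith)
      have hstep : lam - 2 * κ / n₀ * (1 - (1 / 2) ^ (k + 1)) =
          ℓ - 2 * κ / n₀ * (1 / 2) ^ (k + 1) := by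
        rw [hℓ, pow_succ]; ring
      rw [hstep]
      have hbern : (n + 1) ^ d * (1 - d / (n + 1)) ≤ n ^ d := by
        have h1 := one_add_mul_le_pow (a := -(1 / (n + 1)))
          (by rw [neg_le_neg_iff, div_le_iff₀ (by positivity)]; linarith) d
        have h2 : n ^ d = (n + 1) ^ d * (1 + -(1 / (n + 1))) ^ d := by
          rw [← mul_pow]; congr 1; field_simp; ring
        rw [h2]
        refine mul_le_mul_of_nonneg_left (le_trans (le_of_eq ?_) h1) (by positivity)
        ring
      have hpow1 : n + 1 ≤ (n + 1) ^ d := le_self_pow₀ (by linarith) (NeZero.ne d)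
      have hmain : (ℓ - 2 * κ / n₀ * (1 / 2) ^ (k + 1)) * (n + 1) ^ d ≤ Real.log B.card - 1 := by
        have h1 : (ℓ - 2 * κ / n₀ * (1 / 2) ^ (k + 1)) * (n + 1) ^ d ≤
            (ℓ - κ / (n + 1)) * (n + 1) ^ d :=
          mul_le_mul_of_nonneg_right (by linarith) (by positivity)
        have h2 : ℓ * ((n + 1) ^ d * (1 - d / (n + 1))) ≤ ℓ * n ^ d :=
          mul_le_mul_of_nonneg_left hbern hℓ0
        have h3 : 1 + ℓ * d * ((n + 1) ^ d / (n + 1)) ≤ κ * ((n + 1) ^ d / (n + 1)) := by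
          have h4 : 1 ≤ (n + 1) ^ d / (n + 1) := by rw [le_div_iff₀ (by positivity)]; linarith
          have h5 : ℓ * d ≤ d * lam := by
            rw [mul_comm]; exact mul_le_mul_of_nonneg_left hℓlam (Nat.cast_nonneg d)
          rw [hκ, add_mul, one_mul]
          exact add_le_add h4 (mul_le_mul_of_nonneg_right h5 (by positivity))
        have h6 : (ℓ - κ / (n + 1)) * (n + 1) ^ d =
            ℓ * (n + 1) ^ d - κ * ((n + 1) ^ d / (n + 1)) := by
          ring
        have h7 : ℓ * ((n + 1) ^ d * (1 - d / (n + 1))) =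
            ℓ * (n + 1) ^ d - ℓ * d * ((n + 1) ^ d / (n + 1)) := by ring
        linarith
      calc (ℓ - 2 * κ / n₀ * (1 / 2) ^ (k + 1)) * (s * (n + 1) ^ d)
          = s * ((ℓ - 2 * κ / n₀ * (1 / 2) ^ (k + 1)) * (n + 1) ^ d) := by ring
        _ ≤ s * (Real.log B.card - 1) := mul_le_mul_of_nonneg_left hmain hs0
        _ ≤ _ := hlog
  refine le_trans (mul_le_mul_of_nonneg_right ?_ (by positivity)) (key k)
  have h1 : 2 * κ / n₀ * (1 - (1 / 2) ^ k) ≤ 2 * κ / n₀ * 1 :=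
    mul_le_mul_of_nonneg_left (by have : (0 : ℝ) < (1 / 2) ^ k := by positivity
                                  linarith) (by positivity)
  linarith

variable [TopologicalSpace C] [DiscreteTopology C]

/-- All blocks of a given level occur in the subshift. -/
lemma card_level_le_ncard_patternsOn (c₀ : C) (n₀ : ℕ) {k : ℕ} (hk : 1 ≤ k) :
    (level c₀ d n₀ k).card ≤
      (patternsOn (limitShift c₀ d n₀).carrier (cube d (level c₀ d n₀ k).side)).ncard := by
  have := finite_cube d (level c₀ d n₀ k).side
  obtain ⟨x, hx⟩ := limitSet_nonempty (d := d) c₀ n₀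
  have hex (c : Fin (level c₀ d n₀ k).card) := exists_block_eq_of_mem_limitSet hx one_pos hk c 0
  choose p _ hp using hex
  let f (c : Fin (level c₀ d n₀ k).card) :
      patternsOn (limitShift c₀ d n₀).carrier (cube d (level c₀ d n₀ k).side) :=
    ⟨_, Set.mem_image_of_mem _ ((limitShift c₀ d n₀).mapsTo (p c) hx)⟩
  have hf : Function.Injective f := by
    intro c c' hcc
    refine separated_level c₀ n₀ k c c' fun v hv => ?_
    rw [← hp c v hv, ← hp c' v hv]
    exact congrFun (congrArg Subtype.val hcc) ⟨v, hv⟩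
  have h := Nat.card_le_card_of_injective f hf
  rwa [Nat.card_fin] at h

lemma le_of_hasTopologicalEntropy_limitShift (c₀ : C) (n₀ : ℕ) {b h : ℝ}
    (hb : ∀ k, b * ((level c₀ d n₀ k).side : ℝ) ^ d ≤ Real.log (level c₀ d n₀ k).card)
    (hh : HasTopologicalEntropy (limitShift c₀ d n₀) h) : b ≤ h := by
  have hside : Tendsto (fun k => (level c₀ d n₀ k).side) atTop atTop :=
    tendsto_atTop_mono (le_side_level c₀ n₀) tendsto_id
  refine ge_of_tendsto (hh.comp hside) ?_
  filter_upwards [eventually_ge_atTop 1] with k hk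
  have h0 : (0 : ℝ) < (level c₀ d n₀ k).side := by
    exact_mod_cast hk.trans (le_side_level c₀ n₀ k)
  rw [Function.comp_apply, le_div_iff₀ (by positivity)]
  refine (hb k).trans (Real.log_le_log ?_ ?_)
  · exact_mod_cast card_level_pos _ _ _
  · exact_mod_cast card_level_le_ncard_patternsOn c₀ n₀ hk

end BlockFamily

/-- Totally strictly ergodic subshifts of entropy close to that of the full shift. -/
theorem exists_totallyStrictlyErgodic_subshift {C : Type*} {d : ℕ} (hd : 1 ≤ d) [Fintype C]
    [TopologicalSpace C] [DiscreteTopology C] [MeasurableSpace C] [BorelSpace C]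
    (hC : 2 ≤ Fintype.card C) {ν : ℝ} (hν0 : 0 < ν) (hν1 : ν < 1) :
    ∃ (X : Subshift C (Fin d → ℤ)) (h : ℝ), IsTotallyStrictlyErgodic (Fin d → ℤ) X.carrier ∧
      HasTopologicalEntropy X h ∧ (1 - ν) * Real.log (Fintype.card C) ≤ h := by
  have : NeZero d := ⟨by omega⟩
  obtain ⟨c₀⟩ : Nonempty C := Fintype.card_pos_iff.1 (by omega)
  have hlog : 0 < Real.log (Fintype.card C) := Real.log_pos (by exact_mod_cast hC)
  obtain ⟨n₀, hn₀⟩ := exists_nat_ge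
    (2 * (1 + d * Real.log (Fintype.card C)) / (ν * Real.log (Fintype.card C)))
  have hpos : 0 < ν * Real.log (Fintype.card C) := mul_pos hν0 hlog
  have hn₀' : 0 < n₀ := by
    have : (0 : ℝ) < n₀ := lt_of_lt_of_le (by positivity) hn₀
    exact_mod_cast this
  rw [div_le_iff₀ hpos, mul_comm] at hn₀
  obtain ⟨h, hh⟩ := exists_hasTopologicalEntropy (X := BlockFamily.limitShift c₀ d n₀)
    (BlockFamily.limitSet_nonempty c₀ n₀)
  refine ⟨BlockFamily.limitShift c₀ d n₀, h, BlockFamily.isTotallyStrictlyErgodic_limitShift, hh,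
      ?_⟩
  refine BlockFamily.le_of_hasTopologicalEntropy_limitShift c₀ n₀
    (BlockFamily.log_card_level_ge c₀ hn₀' hν1.le ?_) hh
  linarith

theorem theorem1 (d : ℕ) (hd : 1 ≤ d) :
    (∀ (C : Type*) [Fintype C] [TopologicalSpace C] [DiscreteTopology C]
        [MeasurableSpace C] [BorelSpace C], 2 ≤ Fintype.card C →
      ∀ ν : ℝ, 0 < ν → ν < 1 →
        ∃ (X : Subshift C (Fin d → ℤ)) (h : ℝ),
          IsTotallyStrictlyErgodic (Fin d → ℤ) X.carrier ∧
          HasTopologicalEntropy X h ∧ (1 - ν) * Real.log (Fintype.card C) ≤ h) ∧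
    (∀ M : ℝ, ∃ (m : ℕ) (X : Subshift (Fin m) (Fin d → ℤ)) (h : ℝ),
      IsTotallyStrictlyErgodic (Fin d → ℤ) X.carrier ∧
      HasTopologicalEntropy X h ∧ 0 < h ∧ M ≤ h) := by
  refine ⟨fun C _ _ _ _ _ hC ν hν0 hν1 => exists_totallyStrictlyErgodic_subshift hd hC hν0 hν1,
    fun M => ?_⟩
  -- with `ν = 1 / 2`, an alphabet of size at least `exp (2 * max M 1)` suffices
  obtain ⟨m, hm⟩ := exists_nat_ge (Real.exp (2 * max M 1))
  have hm0 : (0 : ℝ) < m := (Real.exp_pos _).trans_le hm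
  have hlog : 2 * max M 1 ≤ Real.log m := (Real.le_log_iff_exp_le hm0).2 hm
  have hmax : 1 ≤ max M 1 := le_max_right _ _
  have hm2 : 2 ≤ m := by
    have : (2 : ℝ) ≤ m := by
      have := Real.add_one_le_exp (2 * max M 1)
      linarith
    exact_mod_cast this
  obtain ⟨X, h, hX, hh, hle⟩ := exists_totallyStrictlyErgodic_subshift (C := Fin m) hd
    (by simpa using hm2) (ν := 1 / 2) (by norm_num) (by norm_num)
  rw [Fintype.card_fin] at hle
  have hM : M ≤ max M 1 := le_max_left _ _
  exact ⟨m, X, h, hX, hh, by linarith, by linarith⟩
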